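/- Let $n\ge 1$ and let $G\subset\mathbb C^n$ be a domain (non-empty, open, connected) that is $n$-circled, i.e. $(e^{i\theta_1}z_1,\dots,e^{i\theta_n}z_n)\in G$ for all $z\in G$ and $\theta\in\mathbb R^n$. Let $\mathcal O(G)$ be the set of holomorphic functions on $G$. For a family $\mathcal F\subset\mathcal O(G)$, the domain $G$ is called an $\mathcal F$-domain of holomorphy if there are no domains $G_0,\widetilde G\subset\mathbb C^n$ with $\varnothing\ne G_0\subset G\cap\widetilde G$ and $\widetilde G\not\subset G$ such that for every $f\in\mathcal F$ there is $\widetilde f\in\mathcal O(\widetilde G)$ with $\widetilde f=f$ on $G_0$; a domain of holomorphy is an $\mathcal O(G)$-domain of holomorphy. Call $G$ fat if $G=\operatorname{int}\overline G$. Put $\log G:=\{x\in\mathbb R^n:(e^{x_1},\dots,e^{x_n})\in G\}$ and let $\mathcal E(\log G)$ be the largest vector subspace $F\subset\mathbb R^n$ with $\log G+F=\log G$. For $k\in\mathbb Z_{\ge0}$ and $p\in[1,\infty]$ put $$L_h^{p,k}(G):=\{f\in\mathcal O(G):\ \partial^\nu f\in L^p(G)\text{ for all }\nu\in\mathbb Z_{\ge0}^n\text{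 with }|\nu|\le k\},\qquad L_h^p(G):=L_h^{p,0}(G),$$ $$L_h^{\diamond,k}(G):=\bigcap_{p\in[1,\infty]}L_h^{p,k}(G),$$ where $\partial^\nu$ denotes the complex partial derivatives and $L^p$ is taken with respect to Lebesgue measure, and let $\mathcal A^k(G)$ be the set of $f\in\mathcal O(G)$ such that for every $\nu$ with $|\nu|\le k$ the derivative $\partial^\nu f$ extends to a continuous function on $\overline G$. Assume that $G$ is a domain of holomorphy. Then the following conditions are equivalent: (i) $G$ is fat and $\mathcal E(\log G)=\{0\}$; (ii) $G$ is fat and there exists $p\in[1,\infty)$ such that $L_h^p(G)\ne\{0\}$; (iii) $G\ne\mathbb C^n$ and, for each $k\in\mathbb Z_{\ge0}$, $G$ is an $L_h^{\diamond,k}(G)\cap\mathcal A^k(G)$-domain of holomorphy. -/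

import Mathlib

open MeasureTheory Set
open scoped ENNReal Pointwise

/-- A domain in `ℂⁿ`: a non-empty connected open set. -/
def IsDomainCn {n : ℕ} (G : Set (Fin n → ℂ)) : Prop :=
  IsOpen G ∧ IsConnected G

/-- `G` is `n`-circled: it is invariant under rotations of the individual coordinates. -/
def IsNCircled {n : ℕ} (G : Set (Fin n → ℂ)) : Prop :=
  ∀ z ∈ G, ∀ θ : Fin n → ℝ,
    (fun j => Complex.exp (Complex.I * (θ j : ℂ)) * z j) ∈ G

/-- `G` is fat: it is the interior of its closure. -/
def IsFat {n : ℕ} (G : Set (Fin n → ℂ)) : Prop :=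
  G = interior (closure G)

/-- The logarithmic image `log G`. -/
def logImage {n : ℕ} (G : Set (Fin n → ℂ)) : Set (Fin n → ℝ) :=
  {x | (fun j => ((Real.exp (x j) : ℝ) : ℂ)) ∈ G}

/-- The largest vector subspace `F` of `ℝⁿ` with `X + F = X`. -/
noncomputable def directionSpace {n : ℕ} (X : Set (Fin n → ℝ)) : Submodule ℝ (Fin n → ℝ) :=
  sSup {F : Submodule ℝ (Fin n → ℝ) | X + (F : Set (Fin n → ℝ)) = X}

/-- The subspace `directionSpace X` is indeed the largest one with the required property. -/
theorem directionSpace_isGreatest {n : ℕ} (X : Set (Fin n → ℝ)) :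
    IsGreatest {F : Submodule ℝ (Fin n → ℝ) | X + (F : Set (Fin n → ℝ)) = X}
      (directionSpace X) := by
  refine ⟨?_, fun F hF => le_sSup hF⟩
  let S : Submodule ℝ (Fin n → ℝ) :=
    { carrier := {v | ∀ x ∈ X, ∀ t : ℝ, x + t • v ∈ X}
      zero_mem' := fun x hx t => by simpa using hx
      add_mem' := fun {v w} hv hw x hx t => by
        have h := hw _ (hv x hx t) t
        rwa [add_assoc, ← smul_add] at h
      smul_mem' := fun c v hv x hx t => by
        have h := hv x hx (t * c)
        rwa [mul_smul] at h }
  have hle : directionSpace X ≤ S := by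
    refine sSup_le fun F hF v hv x hx t => ?_
    have h : x + t • v ∈ X + (F : Set (Fin n → ℝ)) :=
      Set.add_mem_add hx (F.smul_mem t hv)
    have hF' : X + (F : Set (Fin n → ℝ)) = X := hF
    rwa [hF'] at h
  show X + (directionSpace X : Set (Fin n → ℝ)) = X
  apply Set.Subset.antisymm
  · rintro _ ⟨x, hx, v, hv, rfl⟩
    simpa using hle hv x hx 1
  · intro x hx
    exact ⟨x, hx, 0, (directionSpace X).zero_mem, by simp⟩

/-- The space `𝒪(G)` of holomorphic functions on the open set `G`. Functions are total; only their
values on `G` matter. -/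
def holFunctions {n : ℕ} (G : Set (Fin n → ℂ)) : Set ((Fin n → ℂ) → ℂ) :=
  {f | DifferentiableOn ℂ f G}

/-- For a family `F` of holomorphic functions on `G`: the set `G` is a domain, and there are no
domains `G₀`, `G'` with `G₀ ⊆ G ∩ G'` and `G' ⊄ G` such that every `f ∈ F` coincides on `G₀` with
some function holomorphic on `G'`. -/
def IsDomainOfHolomorphyFor {n : ℕ} (F : Set ((Fin n → ℂ) → ℂ)) (G : Set (Fin n → ℂ)) : Prop :=
  IsDomainCn G ∧
    ¬ ∃ G₀ G' : Set (Fin n → ℂ), IsDomainCn G₀ ∧ IsDomainCn G' ∧ G₀ ⊆ G ∩ G' ∧ ¬ G' ⊆ G ∧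
      ∀ f ∈ F, ∃ g ∈ holFunctions G', EqOn g f G₀

/-- A domain of holomorphy. -/
def IsDomainOfHolomorphy {n : ℕ} (G : Set (Fin n → ℂ)) : Prop :=
  IsDomainOfHolomorphyFor (holFunctions G) G

/-- The complex partial derivative `∂f/∂z_j`. -/
noncomputable def complexPartial {n : ℕ} (j : Fin n) (f : (Fin n → ℂ) → ℂ) :
    (Fin n → ℂ) → ℂ :=
  fun z => lineDeriv ℂ f z (Pi.single j 1)

/-- The derivative `∂^ν f = ∂^|ν| f / ∂z_1^ν_1 ⋯ ∂z_n^ν_n`. -/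
noncomputable def multiPartial {n : ℕ} (ν : Fin n → ℕ) (f : (Fin n → ℂ) → ℂ) :
    (Fin n → ℂ) → ℂ :=
  (List.finRange n).foldr (fun j g => (complexPartial j)^[ν j] g) f

/-- `L_h^{p,k}(G)`: holomorphic functions on `G` all of whose derivatives up to order `k` are
in `L^p(G)`, for Lebesgue measure on `ℂⁿ`. -/
def LhSpace {n : ℕ} (p : ℝ≥0∞) (k : ℕ) (G : Set (Fin n → ℂ)) : Set ((Fin n → ℂ) → ℂ) :=
  {f | f ∈ holFunctions G ∧
    ∀ ν : Fin n → ℕ, ∑ j, ν j ≤ k → MemLp (multiPartial ν f) p (volume.restrict G)}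

/-- `L_h^{⋄,k}(G)`: the intersection of `L_h^{p,k}(G)` over all `p ∈ [1, ∞]`. -/
def LhDiamond {n : ℕ} (k : ℕ) (G : Set (Fin n → ℂ)) : Set ((Fin n → ℂ) → ℂ) :=
  {f | ∀ p : ℝ≥0∞, 1 ≤ p → f ∈ LhSpace p k G}

/-- `𝒜^k(G)`: holomorphic functions on `G` all of whose derivatives up to order `k` extend
continuously to the closure of `G`. -/
def AkSpace {n : ℕ} (k : ℕ) (G : Set (Fin n → ℂ)) : Set ((Fin n → ℂ) → ℂ) :=
  {f | f ∈ holFunctions G ∧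
    ∀ ν : Fin n → ℕ, ∑ j, ν j ≤ k →
      ∃ g : (Fin n → ℂ) → ℂ, ContinuousOn g (closure G) ∧ EqOn g (multiPartial ν f) G}

/-!
Write `X = logImage G`, an open connected subset of `ℝⁿ`. The Fourier coefficients of a holomorphic
function `f` on the torus with logarithmic coordinates `x ∈ X` are `a α * exp ⟨α, x⟩` with `a α`
independent of `x` (`exists_hasLaurentCoeff`), and they decay exponentially in `α`, a property that
passes to the convex hull of `X`. The Laurent series of `f` therefore converges over the convex
hull (`ExpDecay.exists_differentiableAt_tsum`), and for a domain of holomorphy `X` is convex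
(`IsDomainOfHolomorphy.convex_logImage`).

*Integrability excludes invariant directions.* If `f ≠ 0` is in `L^p`, then averaging over rotations
shows that some monomial `z ^ α` is in `L^p` as well. If `X + ℝ v = X` with `v ≠ 0`, then along `v` or
`-v` there are infinitely many disjoint polydiscs in `G` on which the integral of `|z ^ α| ^ p` is
bounded below, which is absurd (`directionSpace_eq_bot_of_memLp`).

*Bounded functions force fatness.* As `X` is convex, `interior (closure G)` exceeds `G` only in the
coordinate hyperplanes. A bounded function has no negative powers of `z j` in its Laurent series if
`interior (closure G)` meets `z j = 0`, so the series extends it to `interior (closure G)`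
(`isFat_of_isDomainOfHolomorphyFor`).

*Existence of functions that do not extend.* If the open convex set `X` contains no line, then by
the Hahn–Banach theorem there are integral functionals `β` that tend to `-∞` on `X` as fast as any
given multiple of `-∑ |x j|`, and every point outside the closure of `X` is separated from `X` by
such a functional `α` (`exists_int_separating`). For `z₀` outside the closure of `G`, with nonzero
coordinates, the quotient `z ^ β / (z ^ α - z₀ ^ α)` has a pole at `z₀`, while its derivatives up to
order `k` are integrable to every power and continuous up to the boundary. Together with fatness
this rules out any extension beyond `G` (`isDomainOfHolomorphyFor_of_directionSpace_eq_bot`).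
-/

/-! ### Logarithmic coordinates and monomials -/

/-- The logarithmic coordinates `(log |z₁|, …, log |zₙ|)`; meaningful when no `z j` vanishes. -/
noncomputable def logAbs {n : ℕ} (z : Fin n → ℂ) : Fin n → ℝ := fun j => Real.log ‖z j‖

/-- The Laurent monomial `z₁ ^ γ₁ ⋯ zₙ ^ γₙ` with integer exponents, for which `0 ^ m = 0` when
`m ≠ 0`, also for negative `m`. -/
noncomputable def laurentMonomial {n : ℕ} (γ : Fin n → ℤ) (z : Fin n → ℂ) : ℂ := ∏ j, z j ^ γ j

/-- The point with logarithmic coordinates `x` and arguments `2πt`. -/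
noncomputable def polarPoint {n : ℕ} (x : Fin n → ℝ) (t : UnitAddTorus (Fin n)) : Fin n → ℂ :=
  fun j => (Real.exp (x j) : ℂ) * ((t j).toCircle : ℂ)

theorem norm_polarPoint {n : ℕ} (x : Fin n → ℝ) (t : UnitAddTorus (Fin n)) (j : Fin n) :
    ‖polarPoint x t j‖ = Real.exp (x j) := by
  simp only [polarPoint, norm_mul, Complex.norm_real, Real.norm_eq_abs, Circle.norm_coe, mul_one,
    abs_of_pos (Real.exp_pos _)]

theorem polarPoint_ne_zero {n : ℕ} (x : Fin n → ℝ) (t : UnitAddTorus (Fin n)) (j : Fin n) :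
    polarPoint x t j ≠ 0 := by
  rw [← norm_pos_iff, norm_polarPoint]; exact Real.exp_pos _

theorem logAbs_polarPoint {n : ℕ} (x : Fin n → ℝ) (t : UnitAddTorus (Fin n)) :
    logAbs (polarPoint x t) = x := by
  funext j; simp [logAbs, norm_polarPoint]

theorem continuous_polarPoint {n : ℕ} :
    Continuous (fun q : (Fin n → ℝ) × UnitAddTorus (Fin n) => polarPoint q.1 q.2) := by
  unfold polarPoint
  refine continuous_pi fun j => Continuous.mul (by fun_prop) ?_
  exact continuous_subtype_val.comp
    (AddCircle.continuous_toCircle.comp ((continuous_apply j).comp continuous_snd))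

theorem exists_polarPoint_eq {n : ℕ} (z : Fin n → ℂ) (hz : ∀ j, z j ≠ 0) :
    ∃ t, polarPoint (logAbs z) t = z := by
  refine ⟨fun j => ((Complex.arg (z j) / (2 * Real.pi) : ℝ) : UnitAddCircle), ?_⟩
  funext j
  have h : 2 * Real.pi / 1 * (Complex.arg (z j) / (2 * Real.pi)) = Complex.arg (z j) := by
    field_simp
  simp only [polarPoint, logAbs, AddCircle.toCircle_apply_mk, h, Circle.coe_exp,
    Real.exp_log (norm_pos_iff.2 (hz j))]
  exact Complex.norm_mul_exp_arg_mul_I (z j)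

theorem continuousAt_logAbs {n : ℕ} {z : Fin n → ℂ} (hz : ∀ j, z j ≠ 0) :
    ContinuousAt logAbs z := by
  refine continuousAt_pi.2 fun j => ?_
  exact ContinuousAt.log (continuous_apply j).norm.continuousAt (norm_ne_zero_iff.2 (hz j))

theorem norm_laurentMonomial {n : ℕ} (γ : Fin n → ℤ) {z : Fin n → ℂ} (hz : ∀ j, z j ≠ 0) :
    ‖laurentMonomial γ z‖ = Real.exp (∑ j, γ j * logAbs z j) := by
  rw [laurentMonomial, norm_prod, Real.exp_sum]
  refine Finset.prod_congr rfl fun j _ => ?_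
  rw [norm_zpow, logAbs, mul_comm, Real.exp_mul, Real.exp_log (norm_pos_iff.2 (hz j)),
    Real.rpow_intCast]

theorem laurentMonomial_ne_zero {n : ℕ} (γ : Fin n → ℤ) {z : Fin n → ℂ} (hz : ∀ j, z j ≠ 0) :
    laurentMonomial γ z ≠ 0 :=
  Finset.prod_ne_zero_iff.2 fun j _ => zpow_ne_zero _ (hz j)

theorem laurentMonomial_eq_zero {n : ℕ} {γ : Fin n → ℤ} {z : Fin n → ℂ} {j : Fin n}
    (hz : z j = 0) (hγ : γ j ≠ 0) : laurentMonomial γ z = 0 :=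
  Finset.prod_eq_zero (Finset.mem_univ j) (by rw [hz, zero_zpow _ hγ])

theorem laurentMonomial_add {n : ℕ} (γ δ : Fin n → ℤ) {z : Fin n → ℂ} (hz : ∀ j, z j ≠ 0) :
    laurentMonomial (γ + δ) z = laurentMonomial γ z * laurentMonomial δ z := by
  simp only [laurentMonomial, ← Finset.prod_mul_distrib, Pi.add_apply, zpow_add₀ (hz _)]

theorem differentiableAt_laurentMonomial {n : ℕ} {γ : Fin n → ℤ} {z : Fin n → ℂ}
    (h : ∀ j, z j ≠ 0 ∨ 0 ≤ γ j) : DifferentiableAt ℂ (laurentMonomial γ) z := by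
  unfold laurentMonomial
  refine (HasFDerivAt.finsetProd fun j _ => DifferentiableAt.hasFDerivAt ?_).differentiableAt
  exact DifferentiableAt.zpow (f := fun w : Fin n → ℂ => w j)
    (differentiableAt_apply (𝕜 := ℂ) j z) (h j)

/-- The points without vanishing coordinates are dense. -/
theorem dense_forall_ne_zero (n : ℕ) : Dense {z : Fin n → ℂ | ∀ j, z j ≠ 0} := by
  have h : {z : Fin n → ℂ | ∀ j, z j ≠ 0} = Set.pi univ fun _ => {0}ᶜ := by
    ext z; simp
  rw [h]
  exact dense_pi _ fun _ _ => dense_compl_singleton 0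

theorem isOpen_forall_ne_zero (n : ℕ) : IsOpen {z : Fin n → ℂ | ∀ j, z j ≠ 0} := by
  simp only [ofPred_forall]
  exact isOpen_iInter_of_finite fun j => isOpen_ne_fun (continuous_apply j) continuous_const

/-! ### The logarithmic image of an `n`-circled domain -/

theorem IsNCircled.mem_of_norm_eq {n : ℕ} {G : Set (Fin n → ℂ)} (hG : IsNCircled G)
    {z w : Fin n → ℂ} (hz : z ∈ G) (h : ∀ j, ‖w j‖ = ‖z j‖) : w ∈ G := by
  have := hG z hz fun j => Complex.arg (w j) - Complex.arg (z j)
  convert this using 1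
  funext j
  have h1 := Complex.norm_mul_exp_arg_mul_I (w j)
  have h2 := Complex.norm_mul_exp_arg_mul_I (z j)
  have h3 : Complex.exp (Complex.I * ((w j).arg - (z j).arg : ℝ)) *
      Complex.exp ((z j).arg * Complex.I) = Complex.exp ((w j).arg * Complex.I) := by
    rw [← Complex.exp_add]
    push_cast
    ring_nf
  calc w j = ‖z j‖ * Complex.exp ((w j).arg * Complex.I) := by rw [← h j, h1]
    _ = Complex.exp (Complex.I * ((w j).arg - (z j).arg : ℝ)) * z j := by
      rw [← h3, mul_left_comm, h2]

theorem IsNCircled.polarPoint_mem_iff {n : ℕ} {G : Set (Fin n → ℂ)} (hG : IsNCircled G)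
    {x : Fin n → ℝ} {t : UnitAddTorus (Fin n)} : polarPoint x t ∈ G ↔ x ∈ logImage G := by
  have h : ∀ j, ‖((Real.exp (x j) : ℝ) : ℂ)‖ = ‖polarPoint x t j‖ := fun j => by
    rw [norm_polarPoint, Complex.norm_real, Real.norm_eq_abs, abs_of_pos (Real.exp_pos _)]
  exact ⟨fun hx => hG.mem_of_norm_eq hx h, fun hx => hG.mem_of_norm_eq hx fun j => (h j).symm⟩

theorem IsNCircled.logAbs_mem_iff {n : ℕ} {G : Set (Fin n → ℂ)} (hG : IsNCircled G)
    {z : Fin n → ℂ} (hz : ∀ j, z j ≠ 0) : logAbs z ∈ logImage G ↔ z ∈ G := by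
  obtain ⟨t, ht⟩ := exists_polarPoint_eq z hz
  rw [← hG.polarPoint_mem_iff (t := t), ht]

theorem isOpen_logImage {n : ℕ} {G : Set (Fin n → ℂ)} (hG : IsOpen G) : IsOpen (logImage G) :=
  hG.preimage (by fun_prop)

theorem IsDomainCn.exists_mem_forall_ne_zero {n : ℕ} {G : Set (Fin n → ℂ)} (hG : IsDomainCn G) :
    ∃ z ∈ G, ∀ j, z j ≠ 0 :=
  (dense_forall_ne_zero n).exists_mem_open hG.1 hG.2.nonempty |>.imp fun _ h => ⟨h.2, h.1⟩

theorem nonempty_logImage {n : ℕ} {G : Set (Fin n → ℂ)} (hG : IsDomainCn G)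
    (hc : IsNCircled G) : (logImage G).Nonempty := by
  obtain ⟨z, hz, h0⟩ := hG.exists_mem_forall_ne_zero
  exact ⟨logAbs z, (hc.logAbs_mem_iff h0).2 hz⟩

/-- Positive vectors of moduli close to those of `z ∈ G` have their logarithms in `logImage G`. -/
theorem exists_box_subset_logImage {n : ℕ} {G : Set (Fin n → ℂ)} (hG : IsOpen G)
    (hc : IsNCircled G) {z : Fin n → ℂ} (hz : z ∈ G) :
    ∃ ε > 0, {x : Fin n → ℝ | ∀ j, |Real.exp (x j) - ‖z j‖| < ε} ⊆ logImage G := by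
  obtain ⟨ε, hε, hb⟩ := Metric.isOpen_iff.1 hG z hz
  refine ⟨ε, hε, fun x hx => ?_⟩
  have hw : (fun j => (Real.exp (x j) : ℂ) * Complex.exp (Complex.arg (z j) * Complex.I)) ∈ G := by
    refine hb ((dist_pi_lt_iff hε).2 fun j => ?_)
    nth_rewrite 2 [← Complex.norm_mul_exp_arg_mul_I (z j)]
    rw [dist_eq_norm, ← sub_mul, norm_mul, Complex.norm_exp_ofReal_mul_I, mul_one,
      ← Complex.ofReal_sub, Complex.norm_real]
    exact hx j
  exact hc.mem_of_norm_eq hw fun j => by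
    rw [norm_mul, Complex.norm_exp_ofReal_mul_I, mul_one]

/-- The boxes of `exists_box_subset_logImage` are connected and arise around every point of `G`,
coordinate hyperplanes included; a separation of `logImage G` would thus separate `G`. -/
theorem isPreconnected_logImage {n : ℕ} {G : Set (Fin n → ℂ)} (hG : IsDomainCn G)
    (hc : IsNCircled G) : IsPreconnected (logImage G) := by
  have hbox : ∀ (z : Fin n → ℂ) (ε : ℝ),
      IsPreconnected {x : Fin n → ℝ | ∀ j, |Real.exp (x j) - ‖z j‖| < ε} := fun z ε => by
    have : {x : Fin n → ℝ | ∀ j, |Real.exp (x j) - ‖z j‖| < ε}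
        = Set.pi univ fun j => {s : ℝ | |Real.exp s - ‖z j‖| < ε} := by ext x; simp
    rw [this]
    refine isPreconnected_univ_pi fun j => Set.OrdConnected.isPreconnected ⟨?_⟩
    intro a ha b hb s hs
    have h1 := Real.exp_le_exp.2 hs.1
    have h2 := Real.exp_le_exp.2 hs.2
    simp only [mem_ofPred_eq, abs_lt] at ha hb ⊢
    constructor <;> linarith
  have hne : ∀ (z : Fin n → ℂ) (ε : ℝ), 0 < ε →
      {x : Fin n → ℝ | ∀ j, |Real.exp (x j) - ‖z j‖| < ε}.Nonempty := fun z ε hε => by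
    refine ⟨fun j => Real.log (‖z j‖ + ε / 2), fun j => ?_⟩
    rw [Real.exp_log (by positivity), add_sub_cancel_left, abs_of_pos] <;> linarith
  intro u v hu hv huv hXu hXv
  by_contra hcon
  have key : ∀ w : Set (Fin n → ℝ),
      IsOpen {z | z ∈ G ∧ ∃ ε > 0, {x : Fin n → ℝ | ∀ j, |Real.exp (x j) - ‖z j‖| < ε} ⊆ w} := by
    intro w
    refine hG.1.inter (Metric.isOpen_iff.2 ?_)
    rintro z ⟨ε, hε, hs⟩
    refine ⟨ε / 2, by positivity, fun z' hz' => ⟨ε / 2, by positivity, fun x hx => hs fun j => ?_⟩⟩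
    have h1 := (dist_pi_lt_iff (by positivity)).1 (Metric.mem_ball.1 hz') j
    rw [dist_eq_norm] at h1
    have h2 := abs_norm_sub_norm_le (z' j) (z j)
    have h3 := hx j
    calc _ ≤ |Real.exp (x j) - ‖z' j‖| + |‖z' j‖ - ‖z j‖| := abs_sub_le _ _ _
      _ < ε := by linarith
  have hsub : ∀ w : Set (Fin n → ℝ), IsOpen w → ∀ x ∈ logImage G, x ∈ w →
      ∃ z ∈ G, ∃ ε > 0, {x : Fin n → ℝ | ∀ j, |Real.exp (x j) - ‖z j‖| < ε} ⊆ w := by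
    intro w hw x hx hxw
    refine ⟨_, hx, ?_⟩
    have hcont : ContinuousAt (fun r : Fin n → ℝ => fun j => Real.log (r j))
        (fun j => Real.exp (x j)) :=
      continuousAt_pi.2 fun j => ContinuousAt.log (continuous_apply j).continuousAt
        (Real.exp_pos _).ne'
    have hm := hcont.preimage_mem_nhds (t := w) (hw.mem_nhds (by simpa using hxw))
    obtain ⟨ε, hε, hb⟩ := Metric.mem_nhds_iff.1 hm
    refine ⟨ε, hε, fun y hy => ?_⟩
    have : (fun j => Real.exp (y j)) ∈ Metric.ball (fun j => Real.exp (x j)) ε := by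
      refine (dist_pi_lt_iff hε).2 fun j => ?_
      have := hy j
      rwa [Complex.norm_real, Real.norm_eq_abs, abs_of_pos (Real.exp_pos _)] at this
    simpa using hb this
  obtain ⟨x, hx, hxu⟩ := hXu
  obtain ⟨y, hy, hyv⟩ := hXv
  obtain ⟨z1, hz1, h1⟩ := hsub u hu x hx hxu
  obtain ⟨z2, hz2, h2⟩ := hsub v hv y hy hyv
  have hcover : G ⊆ {z | z ∈ G ∧ ∃ ε > 0, {x : Fin n → ℝ | ∀ j, |Real.exp (x j) - ‖z j‖| < ε} ⊆ u}
      ∪ {z | z ∈ G ∧ ∃ ε > 0, {x : Fin n → ℝ | ∀ j, |Real.exp (x j) - ‖z j‖| < ε} ⊆ v} := by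
    intro z hz
    obtain ⟨ε, hε, hb⟩ := exists_box_subset_logImage hG.1 hc hz
    have := (isPreconnected_iff_subset_of_disjoint.1 (hbox z ε)) u v hu hv (hb.trans huv) (by
      by_contra hne
      obtain ⟨p, hp⟩ := nonempty_iff_ne_empty.2 hne
      exact hcon ⟨p, hb hp.1, hp.2⟩)
    exact this.imp (fun h => ⟨hz, ε, hε, h⟩) (fun h => ⟨hz, ε, hε, h⟩)
  obtain ⟨z, hz, ⟨-, ε, hε, hu'⟩, ⟨-, δ, hδ, hv'⟩⟩ :=
    hG.2.isPreconnected _ _ (key u) (key v) hcover ⟨z1, hz1, hz1, h1⟩ ⟨z2, hz2, hz2, h2⟩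
  obtain ⟨p, hp⟩ := hne z (min ε δ) (lt_min hε hδ)
  obtain ⟨ρ, hρ, hb⟩ := exists_box_subset_logImage hG.1 hc hz
  obtain ⟨q, hq⟩ := hne z (min ρ (min ε δ)) (lt_min hρ (lt_min hε hδ))
  exact hcon ⟨q, hb fun j => (hq j).trans_le (min_le_left _ _),
    hu' fun j => (hq j).trans_le ((min_le_right _ _).trans (min_le_left _ _)),
    hv' fun j => (hq j).trans_le ((min_le_right _ _).trans (min_le_right _ _))⟩

theorem polarPoint_mem_closure {n : ℕ} {G : Set (Fin n → ℂ)} (hc : IsNCircled G)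
    {x : Fin n → ℝ} (hx : x ∈ closure (logImage G)) (t : UnitAddTorus (Fin n)) :
    polarPoint x t ∈ closure G :=
  map_mem_closure (f := fun y => polarPoint y t)
    (continuous_polarPoint.comp (Continuous.prodMk_left t)) hx
    fun _ hy => hc.polarPoint_mem_iff.2 hy

theorem logAbs_mem_closure {n : ℕ} {G : Set (Fin n → ℂ)} (hc : IsNCircled G)
    {z : Fin n → ℂ} (hz : z ∈ closure G) (h0 : ∀ j, z j ≠ 0) :
    logAbs z ∈ closure (logImage G) := by
  have hz' : z ∈ closure (G ∩ {z | ∀ j, z j ≠ 0}) := by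
    rw [inter_comm]
    exact (isOpen_forall_ne_zero n).inter_closure ⟨h0, hz⟩
  exact (continuousAt_logAbs h0).continuousWithinAt.mem_closure hz'
    fun w hw => (hc.logAbs_mem_iff hw.2).2 hw.1

/-- Off the coordinate hyperplanes an `n`-circled domain with convex logarithmic image is already
the interior of its closure. -/
theorem mem_of_mem_interior_closure {n : ℕ} {G : Set (Fin n → ℂ)} (hG : IsOpen G)
    (hc : IsNCircled G) (hX : Convex ℝ (logImage G)) {z : Fin n → ℂ}
    (hz : z ∈ interior (closure G)) (h0 : ∀ j, z j ≠ 0) : z ∈ G := by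
  have hne : (interior (logImage G)).Nonempty := by
    rw [(isOpen_logImage hG).interior_eq]
    have : logAbs z ∈ closure (logImage G) := logAbs_mem_closure hc (interior_subset hz) h0
    exact closure_nonempty_iff.1 ⟨_, this⟩
  rw [← hc.logAbs_mem_iff h0, ← (isOpen_logImage hG).interior_eq,
    ← hX.interior_closure_eq_interior_of_nonempty_interior hne]
  obtain ⟨t, ht⟩ := exists_polarPoint_eq z h0
  have hc' : Continuous fun x : Fin n → ℝ => polarPoint x t :=
    continuous_polarPoint.comp (Continuous.prodMk_left t)
  refine mem_interior.2 ⟨_, ?_, isOpen_interior.preimage hc', by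
    rw [mem_preimage, ht]; exact hz⟩
  intro x hx
  have := logAbs_mem_closure hc (interior_subset hx) (polarPoint_ne_zero x t)
  rwa [logAbs_polarPoint] at this

/-! ### Holomorphic functions on normed spaces -/

/-- A holomorphic function vanishing near a point of a connected open set vanishes on the whole
set; this follows from the one-variable identity theorem on complex lines. -/
theorem DifferentiableOn.eqOn_zero_of_eventuallyEq {E : Type*} [NormedAddCommGroup E]
    [NormedSpace ℂ E] {U : Set E} (hU : IsOpen U) (hc : IsPreconnected U) {f : E → ℂ}
    (hf : DifferentiableOn ℂ f U) {z : E} (hz : z ∈ U) (h0 : f =ᶠ[nhds z] 0) :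
    EqOn f 0 U := by
  have hsub : U ⊆ {w | f =ᶠ[nhds w] 0} := by
    refine hc.subset_of_closure_inter_subset isOpen_setOfPred_eventually_nhds ⟨z, hz, h0⟩ ?_
    rintro w ⟨hw, hwU⟩
    obtain ⟨r, hr, hb⟩ := Metric.isOpen_iff.1 hU w hwU
    obtain ⟨v, hv, hvw⟩ := Metric.mem_closure_iff.1 hw r hr
    rw [dist_comm] at hvw
    refine Filter.eventually_of_mem (Metric.ball_mem_nhds w hr) fun p hp => ?_
    let l : ℂ → E := fun ζ => v + ζ • (p - v)
    have hl : Differentiable ℂ l := by fun_prop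
    have hV : Convex ℝ (l ⁻¹' Metric.ball w r) := by
      have : l = fun ζ => AffineMap.lineMap (k := ℂ) v p ζ := by
        funext ζ; simp [l, AffineMap.lineMap_apply, add_comm]
      intro a ha b hb s t hs ht hst
      have hconv := convex_ball w r ha hb hs ht hst
      have : l (s • a + t • b) = s • l a + t • l b := by
        have hv' : v = s • v + t • v := by rw [← add_smul, hst, one_smul]
        simp only [l, smul_add, add_smul, smul_assoc]
        nth_rewrite 1 [hv']
        abel
      rw [mem_preimage, this]; exact hconv
    have hVo : IsOpen (l ⁻¹' Metric.ball w r) := Metric.isOpen_ball.preimage hl.continuous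
    have hd : DifferentiableOn ℂ (f ∘ l) (l ⁻¹' Metric.ball w r) :=
      (hf.mono hb).comp hl.differentiableOn fun _ h => h
    have hl0 : l 0 = v := by simp [l]
    have hl1 : l 1 = p := by simp [l]
    have hev : f ∘ l =ᶠ[nhds 0] 0 := by
      have ht : Filter.Tendsto l (nhds 0) (nhds v) := hl0 ▸ hl.continuous.tendsto 0
      exact ht.eventually hv
    have := (hd.analyticOnNhd hVo).eqOn_zero_of_preconnected_of_eventuallyEq_zero
      hV.isPreconnected (z₀ := 0) (by rw [mem_preimage, hl0]; exact hvw) hev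
      (x := 1) (by rw [mem_preimage, hl1]; exact hp)
    simpa [hl1] using this
  exact fun w hw => (hsub hw).self_of_nhds

/-- A series of holomorphic functions dominated by a summable sequence of constants has a
holomorphic sum: by the Schwarz lemma the derivatives are dominated as well. -/
theorem differentiableOn_tsum_of_norm_le {E ι : Type*} [NormedAddCommGroup E]
    [NormedSpace ℂ E] {U : Set E} (hU : IsOpen U) {f : ι → E → ℂ} {u : ι → ℝ} (hu : Summable u)
    (hf : ∀ i, DifferentiableOn ℂ (f i) U) (hb : ∀ i, ∀ z ∈ U, ‖f i z‖ ≤ u i) :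
    DifferentiableOn ℂ (fun z => ∑' i, f i z) U := by
  intro z hz
  obtain ⟨r, hr, hball⟩ := Metric.isOpen_iff.1 hU z hz
  have hin : ∀ w ∈ Metric.ball z (r / 2), Metric.ball w (r / 2) ⊆ U := fun w hw =>
    (Metric.ball_subset_ball' (by have := Metric.mem_ball.1 hw; linarith)).trans hball
  have hself : ∀ w ∈ Metric.ball z (r / 2), w ∈ U := fun w hw =>
    hin w hw (Metric.mem_ball_self (by positivity))
  let _ : NormedSpace ℝ E := NormedSpace.restrictScalars ℝ ℂ E
  have hzm : z ∈ Metric.ball z (r / 2) := Metric.mem_ball_self (by positivity)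
  refine (hasFDerivAt_tsum_of_isPreconnected (f' := fun i w => fderiv ℂ (f i) w)
    (hu.mul_left (2 / (r / 2))) Metric.isOpen_ball
    (convex_ball z (r / 2)).isPreconnected ?_ ?_ hzm ?_ hzm).differentiableAt.differentiableWithinAt
  · exact fun i w hw => ((hf i).differentiableAt (hU.mem_nhds (hself w hw))).hasFDerivAt
  · intro i w hw
    refine (Complex.norm_fderiv_le_div_of_mapsTo_ball (R₂ := 2 * u i) ((hf i).mono (hin w hw)) ?_
      (by positivity)).trans (le_of_eq (by ring))
    intro p hp
    rw [Metric.mem_closedBall, dist_eq_norm]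
    calc _ ≤ ‖f i p‖ + ‖f i w‖ := norm_sub_le _ _
      _ ≤ 2 * u i := by linarith [hb i p (hin w hw hp), hb i w (hself w hw)]
  · exact Summable.of_norm_bounded hu fun i => hb i z hz

/-! ### Means over tori and Laurent coefficients -/

/-- The normalized Haar measure of the torus. -/
noncomputable abbrev torusMeasure (n : ℕ) : Measure (UnitAddTorus (Fin n)) :=
  Measure.pi fun _ => AddCircle.haarAddCircle

/-- The mean of `φ` over the torus of points with logarithmic coordinates `x`. -/
noncomputable def torusMean {n : ℕ} (φ : (Fin n → ℂ) → ℂ) (x : Fin n → ℝ) : ℂ :=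
  ∫ t, φ (polarPoint x t) ∂(torusMeasure n)

/-- The mean of a function over a circle does not depend on the radius while the function is
holomorphic on the annulus in between. -/
theorem integral_haarAddCircle_eq_of_annulus {ψ : ℂ → ℂ} {r R : ℝ} (hr : 0 < r) (hrR : r ≤ R)
    (hψ : ∀ w : ℂ, r ≤ ‖w‖ → ‖w‖ ≤ R → DifferentiableAt ℂ ψ w) :
    ∫ s : UnitAddCircle, ψ (R * (s.toCircle : ℂ)) ∂AddCircle.haarAddCircle
      = ∫ s : UnitAddCircle, ψ (r * (s.toCircle : ℂ)) ∂AddCircle.haarAddCircle := by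
  have key : ∀ ρ : ℝ, ρ ≠ 0 → ∫ s : UnitAddCircle, ψ (ρ * (s.toCircle : ℂ)) ∂AddCircle.haarAddCircle
      = (2 * Real.pi * Complex.I)⁻¹ • ∮ w in C(0, ρ), (w - 0)⁻¹ • ψ w := by
    intro ρ hρ
    have hvol : (AddCircle.haarAddCircle : Measure UnitAddCircle) = volume := by
      rw [AddCircle.volume_eq_smul_haarAddCircle]; simp
    rw [hvol, ← UnitAddCircle.intervalIntegral_preimage 0, ← Real.circleAverage_eq_circleIntegral hρ,
      Real.circleAverage, zero_add]
    have h := intervalIntegral.integral_comp_mul_left (a := 0) (b := 1)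
      (fun θ => ψ (circleMap 0 ρ θ)) (c := 2 * Real.pi) (by positivity)
    rw [mul_zero, mul_one] at h
    rw [← h]
    refine intervalIntegral.integral_congr fun a _ => ?_
    simp [circleMap, AddCircle.toCircle_apply_mk]
  rw [key R (hr.trans_le hrR).ne', key r hr.ne']
  congr 1
  refine Complex.circleIntegral_sub_center_inv_smul_eq_of_differentiable_on_annulus_off_countable
    hr hrR countable_empty (fun w hw => ?_) fun w hw => ?_
  · rw [mem_sdiff, mem_closedBall_zero_iff, mem_ball_zero_iff, not_lt] at hw
    exact (hψ w hw.2 hw.1).continuousAt.continuousWithinAt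
  · rw [sdiff_empty, mem_sdiff, mem_ball_zero_iff, mem_closedBall_zero_iff, not_le] at hw
    exact hψ w hw.2.le hw.1.le

theorem polarPoint_add_single {n : ℕ} (x : Fin n → ℝ) (t : UnitAddTorus (Fin n)) (j : Fin n)
    (r : ℝ) (s : UnitAddCircle) :
    polarPoint (Function.update x j r) (t + Pi.single j s)
      = Function.update (polarPoint x t) j
        (((t j).toCircle : ℂ) * (Real.exp r * (s.toCircle : ℂ))) := by
  funext i
  rcases eq_or_ne i j with rfl | h
  · simp [polarPoint, AddCircle.toCircle_add]; ring
  · simp [polarPoint, h]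

theorem continuous_comp_polarPoint {n : ℕ} {X : Set (Fin n → ℝ)} {φ : (Fin n → ℂ) → ℂ}
    (hφ : ∀ z : Fin n → ℂ, (∀ j, z j ≠ 0) → logAbs z ∈ X → DifferentiableAt ℂ φ z)
    {x : Fin n → ℝ} (hx : x ∈ X) : Continuous fun t => φ (polarPoint x t) :=
  continuous_iff_continuousAt.2 fun t =>
    ContinuousAt.comp (f := fun t => polarPoint x t) (x := t)
      (hφ _ (polarPoint_ne_zero x t) (by rwa [logAbs_polarPoint])).continuousAt
      (continuous_polarPoint.comp (Continuous.prodMk_right x)).continuousAt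

/-- Averaging first over the rotations of the `j`-th coordinate reduces the change of a single
logarithmic coordinate to the case of an annulus. -/
theorem torusMean_update {n : ℕ} {X : Set (Fin n → ℝ)} {φ : (Fin n → ℂ) → ℂ}
    (hφ : ∀ z : Fin n → ℂ, (∀ j, z j ≠ 0) → logAbs z ∈ X → DifferentiableAt ℂ φ z)
    {x : Fin n → ℝ} {j : Fin n} {a b : ℝ} (hab : a ≤ b)
    (h : ∀ s ∈ Icc a b, Function.update x j s ∈ X) :
    torusMean φ (Function.update x j b) = torusMean φ (Function.update x j a) := by
  have key : ∀ s ∈ Icc a b, torusMean φ (Function.update x j s) =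
      ∫ t, ∫ v : UnitAddCircle, φ (polarPoint (Function.update x j s) (t + Pi.single j v))
        ∂AddCircle.haarAddCircle ∂(torusMeasure n) := by
    intro s hs
    have hcont := continuous_comp_polarPoint hφ (h s hs)
    rw [integral_integral_swap]
    · rw [torusMean]
      have : ∀ v : UnitAddCircle, ∫ t, φ (polarPoint (Function.update x j s) (t + Pi.single j v))
          ∂(torusMeasure n) = ∫ t, φ (polarPoint (Function.update x j s) t) ∂(torusMeasure n) :=
        fun v => integral_add_right_eq_self
          (fun t => φ (polarPoint (Function.update x j s) t)) (Pi.single j v)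
      simp only [this, integral_const, probReal_univ, one_smul]
    · have hc : Continuous (Function.uncurry fun (t : UnitAddTorus (Fin n)) (v : UnitAddCircle) =>
          φ (polarPoint (Function.update x j s) (t + Pi.single j v))) := by
        refine hcont.comp (continuous_fst.add ?_)
        exact (continuous_single j).comp continuous_snd
      rw [← integrableOn_univ]
      exact hc.continuousOn.integrableOn_compact isCompact_univ
  rw [key b (right_mem_Icc.2 hab), key a (left_mem_Icc.2 hab)]
  refine integral_congr_ae (Filter.Eventually.of_forall fun t => ?_)
  simp only [polarPoint_add_single]
  refine integral_haarAddCircle_eq_of_annulus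
    (ψ := fun w => φ (Function.update (polarPoint x t) j (((t j).toCircle : ℂ) * w)))
    (Real.exp_pos a) (Real.exp_le_exp.2 hab) fun w hw1 hw2 => ?_
  have hw0 : 0 < ‖w‖ := (Real.exp_pos a).trans_le hw1
  have hd : DifferentiableAt ℂ
      (fun w : ℂ => Function.update (polarPoint x t) j (((t j).toCircle : ℂ) * w)) w := by
    refine differentiableAt_pi.2 fun i => ?_
    rcases eq_or_ne i j with rfl | hi
    · simp only [Function.update_self]; fun_prop
    · simp only [Function.update_of_ne hi]; fun_prop
  refine DifferentiableAt.comp w (hφ _ (fun i => ?_) ?_) hd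
  · rcases eq_or_ne i j with rfl | hi
    · rw [Function.update_self, ← norm_pos_iff, norm_mul, Circle.norm_coe, one_mul]; exact hw0
    · rw [Function.update_of_ne hi]; exact polarPoint_ne_zero x t i
  · have : logAbs (Function.update (polarPoint x t) j (((t j).toCircle : ℂ) * w))
        = Function.update x j (Real.log ‖w‖) := by
      funext i
      rcases eq_or_ne i j with rfl | hi
      · simp only [logAbs, Function.update_self, norm_mul, Circle.norm_coe, one_mul]
      · simp only [logAbs, Function.update_of_ne hi, norm_polarPoint, Real.log_exp]
    rw [this]
    exact h _ ⟨(Real.le_log_iff_exp_le hw0).2 hw1, (Real.log_le_iff_le_exp hw0).2 hw2⟩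

theorem torusMean_eq {n : ℕ} {X : Set (Fin n → ℝ)} (hX : IsOpen X) (hc : IsPreconnected X)
    {φ : (Fin n → ℂ) → ℂ}
    (hφ : ∀ z : Fin n → ℂ, (∀ j, z j ≠ 0) → logAbs z ∈ X → DifferentiableAt ℂ φ z)
    {x y : Fin n → ℝ} (hx : x ∈ X) (hy : y ∈ X) : torusMean φ x = torusMean φ y := by
  refine hc.induction₂ (fun x y => torusMean φ x = torusMean φ y) (fun x hx => ?_)
    (fun _ _ _ _ _ _ h1 h2 => h1.trans h2) (fun _ _ _ _ h => h.symm) hx hy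
  obtain ⟨ε, hε, hb⟩ := Metric.isOpen_iff.1 hX x hx
  filter_upwards [mem_nhdsWithin_of_mem_nhds (Metric.ball_mem_nhds x hε)] with y hy
  rw [Metric.mem_ball, dist_pi_lt_iff hε] at hy
  -- pass from `x` to `y` by changing one coordinate at a time
  have : ∀ s : Finset (Fin n), torusMean φ x = torusMean φ (s.piecewise y x) := by
    intro s
    induction s using Finset.induction with
    | empty => simp
    | insert j s hj ih =>
      rw [ih, Finset.piecewise_insert]
      have hupd : s.piecewise y x = Function.update (s.piecewise y x) j (x j) := by
        rw [eq_comm, Function.update_eq_self_iff, Finset.piecewise_eq_of_notMem _ _ _ hj]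
      have hmem : ∀ u : ℝ, |u - x j| < ε → Function.update (s.piecewise y x) j u ∈ X := by
        intro u hu
        refine hb ((dist_pi_lt_iff hε).2 fun i => ?_)
        rcases eq_or_ne i j with rfl | hi
        · rw [Function.update_self, Real.dist_eq]; exact hu
        · rw [Function.update_of_ne hi]
          by_cases his : i ∈ s
          · rw [Finset.piecewise_eq_of_mem _ _ _ his]; exact hy i
          · rw [Finset.piecewise_eq_of_notMem _ _ _ his, dist_self]; exact hε
      have hyj := hy j
      rw [Real.dist_eq, abs_lt] at hyj
      rcases le_total (x j) (y j) with hle | hle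
      · have := torusMean_update hφ (x := s.piecewise y x) (j := j) hle fun u hu => hmem u
          (abs_lt.2 ⟨by linarith [hu.1, hu.2], by linarith [hu.1, hu.2]⟩)
        rw [this, ← hupd]
      · have := torusMean_update hφ (x := s.piecewise y x) (j := j) hle fun u hu => hmem u
          (abs_lt.2 ⟨by linarith [hu.1, hu.2], by linarith [hu.1, hu.2]⟩)
        rw [← this, ← hupd]
  simpa using this Finset.univ

theorem laurentMonomial_polarPoint {n : ℕ} (α : Fin n → ℤ) (x : Fin n → ℝ)
    (t : UnitAddTorus (Fin n)) : laurentMonomial α (polarPoint x t)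
      = (Real.exp (∑ j, α j * x j) : ℂ) * UnitAddTorus.mFourier α t := by
  rw [Real.exp_sum, Complex.ofReal_prod]
  change _ = _ * ∏ j, fourier (α j) (t j)
  rw [← Finset.prod_mul_distrib, laurentMonomial]
  refine Finset.prod_congr rfl fun j _ => ?_
  rw [polarPoint, mul_zpow, fourier_apply, AddCircle.toCircle_zsmul, mul_comm (α j : ℝ),
    Real.exp_mul, Real.rpow_intCast, Circle.coe_zpow]
  push_cast
  rfl

/-- The numbers `a α` are the Laurent coefficients of `f`, given through the Fourier coefficients
of `f` on the tori with logarithmic coordinates in `X`. -/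
def HasLaurentCoeff {n : ℕ} (f : (Fin n → ℂ) → ℂ) (X : Set (Fin n → ℝ))
    (a : (Fin n → ℤ) → ℂ) : Prop :=
  ∀ x ∈ X, ∀ α, UnitAddTorus.mFourierCoeff (fun t => f (polarPoint x t)) α
    = a α * Real.exp (∑ j, α j * x j)

theorem differentiableAt_of_logAbs_mem {n : ℕ} {G : Set (Fin n → ℂ)} (hG : IsOpen G)
    (hc : IsNCircled G) {f : (Fin n → ℂ) → ℂ} (hf : DifferentiableOn ℂ f G) :
    ∀ z : Fin n → ℂ, (∀ j, z j ≠ 0) → logAbs z ∈ logImage G → DifferentiableAt ℂ f z :=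
  fun _ h0 hz => hf.differentiableAt (hG.mem_nhds ((hc.logAbs_mem_iff h0).1 hz))

theorem exists_hasLaurentCoeff {n : ℕ} {G : Set (Fin n → ℂ)} (hG : IsDomainCn G)
    (hc : IsNCircled G) {f : (Fin n → ℂ) → ℂ} (hf : DifferentiableOn ℂ f G) :
    ∃ a, HasLaurentCoeff f (logImage G) a := by
  obtain ⟨x₀, hx₀⟩ := nonempty_logImage hG hc
  refine ⟨fun α => torusMean (fun z => laurentMonomial (-α) z * f z) x₀, fun x hx α => ?_⟩
  have h := torusMean_eq (isOpen_logImage hG.1) (isPreconnected_logImage hG hc)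
    (φ := fun z => laurentMonomial (-α) z * f z) (fun z h0 hz =>
      (differentiableAt_laurentMonomial fun j => Or.inl (h0 j)).mul
        (differentiableAt_of_logAbs_mem hG.1 hc hf z h0 hz)) hx₀ hx
  change _ = torusMean (fun z => laurentMonomial (-α) z * f z) x₀ * _
  rw [h, torusMean]
  simp only [laurentMonomial_polarPoint, mul_assoc]
  rw [integral_const_mul, mul_right_comm, ← Complex.ofReal_mul, ← Real.exp_add]
  simp only [Pi.neg_apply, Int.cast_neg, neg_mul, Finset.sum_neg_distrib, neg_add_cancel,
    Real.exp_zero, Complex.ofReal_one, one_mul]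
  rfl

theorem HasLaurentCoeff.norm_le {n : ℕ} {f : (Fin n → ℂ) → ℂ} {X : Set (Fin n → ℝ)}
    {a : (Fin n → ℤ) → ℂ} (h : HasLaurentCoeff f X a) {x : Fin n → ℝ} (hx : x ∈ X) {C : ℝ}
    (hC : ∀ t, ‖f (polarPoint x t)‖ ≤ C) (α : Fin n → ℤ) :
    ‖a α‖ * Real.exp (∑ j, α j * x j) ≤ C := by
  have h1 : ‖UnitAddTorus.mFourierCoeff (fun t => f (polarPoint x t)) α‖ ≤ C := by
    have := norm_integral_le_of_norm_le_const (μ := torusMeasure n)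
      (f := fun t => UnitAddTorus.mFourier (-α) t • f (polarPoint x t)) (C := C)
      (Filter.Eventually.of_forall fun t => ?_)
    · rw [probReal_univ, mul_one] at this
      exact this
    · rw [norm_smul]
      refine (mul_le_mul ((UnitAddTorus.mFourier (-α)).norm_coe_le_norm t) (hC t)
        (norm_nonneg _) (norm_nonneg _)).trans ?_
      rw [UnitAddTorus.mFourier_norm, one_mul]
  rw [h x hx α, norm_mul, Complex.norm_real, Real.norm_eq_abs, abs_of_pos (Real.exp_pos _)] at h1
  exact h1

/-- Where the Laurent series converges absolutely it represents the function. -/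
theorem HasLaurentCoeff.tsum_eq {n : ℕ} {f : (Fin n → ℂ) → ℂ} {X : Set (Fin n → ℝ)}
    {a : (Fin n → ℤ) → ℂ} (h : HasLaurentCoeff f X a) {x : Fin n → ℝ} (hx : x ∈ X)
    (hf : Continuous fun t => f (polarPoint x t))
    (hs : Summable fun α : Fin n → ℤ => ‖a α‖ * Real.exp (∑ j, α j * x j))
    (t : UnitAddTorus (Fin n)) :
    ∑' α, a α * laurentMonomial α (polarPoint x t) = f (polarPoint x t) := by
  have hs' : Summable (UnitAddTorus.mFourierCoeff (fun t => f (polarPoint x t))) := by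
    refine Summable.of_norm (hs.congr fun α => ?_)
    rw [h x hx α, norm_mul, Complex.norm_real, Real.norm_eq_abs, abs_of_pos (Real.exp_pos _)]
  have := (UnitAddTorus.hasSum_mFourier_series_apply_of_summable
    (f := ⟨fun t => f (polarPoint x t), hf⟩) hs' t).tsum_eq
  simp only [ContinuousMap.coe_mk] at this
  rw [← this]
  refine tsum_congr fun α => ?_
  rw [h x hx α, laurentMonomial_polarPoint, smul_eq_mul, mul_assoc]

/-! ### Convergence of Laurent series -/

theorem summable_exp_neg_sum_abs (n : ℕ) {ε : ℝ} (hε : 0 < ε) :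
    Summable fun α : Fin n → ℤ => Real.exp (-(ε * ∑ j, |(α j : ℝ)|)) := by
  have h1 : Summable fun m : ℤ => Real.exp (-(ε * |(m : ℝ)|)) := by
    have h : Summable fun m : ℕ => Real.exp (-(ε * (m : ℝ))) := by
      have := Real.summable_exp_nat_mul_iff.2 (neg_lt_zero.2 hε)
      exact this.congr fun m => by ring_nf
    exact Summable.of_nat_of_neg (h.congr fun m => by simp) (h.congr fun m => by simp)
  induction n with
  | zero => exact (hasSum_fintype _).summable
  | succ n ih =>
    rw [← (Fin.consEquiv fun _ : Fin (n + 1) => ℤ).summable_iff]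
    refine (h1.mul_of_nonneg ih (fun _ => (Real.exp_pos _).le)
      (fun _ => (Real.exp_pos _).le)).congr fun p => ?_
    rw [← Real.exp_add, Function.comp_apply, Fin.sum_univ_succ]
    simp [Fin.consEquiv]
    ring

/-- The terms `a α * exp ⟨α, x⟩` decay exponentially. -/
def ExpDecay {n : ℕ} (a : (Fin n → ℤ) → ℂ) (x : Fin n → ℝ) : Prop :=
  ∃ ε > 0, ∃ M, ∀ α, ‖a α‖ * Real.exp (∑ j, α j * x j + ε * ∑ j, |(α j : ℝ)|) ≤ M

theorem ExpDecay.summable {n : ℕ} {a : (Fin n → ℤ) → ℂ} {x : Fin n → ℝ} (h : ExpDecay a x) :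
    Summable fun α : Fin n → ℤ => ‖a α‖ * Real.exp (∑ j, α j * x j) := by
  obtain ⟨ε, hε, M, hM⟩ := h
  refine Summable.of_nonneg_of_le (fun α => by positivity) (fun α => ?_)
    ((summable_exp_neg_sum_abs n hε).mul_left M)
  have h1 : Real.exp (∑ j, α j * x j) = Real.exp (∑ j, α j * x j + ε * ∑ j, |(α j : ℝ)|)
      * Real.exp (-(ε * ∑ j, |(α j : ℝ)|)) := by rw [← Real.exp_add, add_neg_cancel_right]
  rw [h1, ← mul_assoc]
  exact mul_le_mul_of_nonneg_right (hM α) (Real.exp_pos _).le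

/-- By log-convexity of the exponential the set of exponents of convergence is convex. -/
theorem convex_setOf_expDecay {n : ℕ} (a : (Fin n → ℤ) → ℂ) : Convex ℝ {x | ExpDecay a x} := by
  rintro x ⟨ε, hε, M, hM⟩ y ⟨δ, hδ, N, hN⟩ s t hs ht hst
  refine ⟨min ε δ, lt_min hε hδ, max M N, fun α => ?_⟩
  have hA : 0 ≤ ∑ j, |(α j : ℝ)| := Finset.sum_nonneg fun _ _ => abs_nonneg _
  have h1 : ∑ j, α j * (s • x + t • y) j + min ε δ * ∑ j, |(α j : ℝ)|
      ≤ max (∑ j, α j * x j + ε * ∑ j, |(α j : ℝ)|) (∑ j, α j * y j + δ * ∑ j, |(α j : ℝ)|) := by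
    have e : ∑ j, α j * (s • x + t • y) j = s * ∑ j, α j * x j + t * ∑ j, α j * y j := by
      rw [Finset.mul_sum, Finset.mul_sum, ← Finset.sum_add_distrib]
      refine Finset.sum_congr rfl fun j _ => ?_
      simp only [Pi.add_apply, Pi.smul_apply, smul_eq_mul]; ring
    rw [e]
    have m1 := le_max_left (∑ j, α j * x j + ε * ∑ j, |(α j : ℝ)|)
      (∑ j, α j * y j + δ * ∑ j, |(α j : ℝ)|)
    have m2 := le_max_right (∑ j, α j * x j + ε * ∑ j, |(α j : ℝ)|)
      (∑ j, α j * y j + δ * ∑ j, |(α j : ℝ)|)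
    have p1 := mul_le_mul_of_nonneg_right (min_le_left ε δ) hA
    have p2 := mul_le_mul_of_nonneg_right (min_le_right ε δ) hA
    have q1 := mul_le_mul_of_nonneg_left (m1.trans' (add_le_add_right p1 _)) hs
    have q2 := mul_le_mul_of_nonneg_left (m2.trans' (add_le_add_right p2 _)) ht
    have := add_le_add q1 q2
    rw [← add_mul, hst, one_mul] at this
    refine le_trans (le_of_eq ?_) this
    have : t = 1 - s := by linarith
    subst this; ring
  rcases le_max_iff.1 h1 with h | h
  · exact (mul_le_mul_of_nonneg_left (Real.exp_le_exp.2 h) (norm_nonneg _)).trans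
      ((hM α).trans (le_max_left _ _))
  · exact (mul_le_mul_of_nonneg_left (Real.exp_le_exp.2 h) (norm_nonneg _)).trans
      ((hN α).trans (le_max_right _ _))

theorem HasLaurentCoeff.expDecay {n : ℕ} {f : (Fin n → ℂ) → ℂ} {X : Set (Fin n → ℝ)}
    (hX : IsOpen X) {a : (Fin n → ℤ) → ℂ} (h : HasLaurentCoeff f X a)
    (hf : ∀ x ∈ X, Continuous fun t => f (polarPoint x t)) {x : Fin n → ℝ} (hx : x ∈ X) :
    ExpDecay a x := by
  obtain ⟨ε, hε, hb⟩ := Metric.isOpen_iff.1 hX x hx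
  -- move `x` towards the corner of a cube that the signs of `α` select
  have hmem : ∀ σ : Fin n → SignType, (fun j => x j + ε / 2 * (σ j : ℝ)) ∈ X := fun σ => by
    refine hb ((dist_pi_lt_iff hε).2 fun j => ?_)
    rw [Real.dist_eq, add_sub_cancel_left]
    have : |ε / 2| < ε := by rw [abs_of_pos (half_pos hε)]; linarith
    cases σ j <;> simp [hε, this]
  have hC : ∀ σ : Fin n → SignType, ∃ C, ∀ t,
      ‖f (polarPoint (fun j => x j + ε / 2 * (σ j : ℝ)) t)‖ ≤ C := fun σ => by
    obtain ⟨C, hC⟩ := isCompact_univ.exists_bound_of_continuousOn (hf _ (hmem σ)).continuousOn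
    exact ⟨C, fun t => hC t (mem_univ t)⟩
  choose C hC using hC
  refine ⟨ε / 2, by positivity, ∑ σ, |C σ|, fun α => ?_⟩
  have hα := h.norm_le (hmem fun j => SignType.sign (α j : ℝ)) (hC _) α
  have e : ∑ j, (α j : ℝ) * (x j + ε / 2 * (SignType.sign (α j : ℝ) : ℝ))
      = ∑ j, α j * x j + ε / 2 * ∑ j, |(α j : ℝ)| := by
    rw [Finset.mul_sum, ← Finset.sum_add_distrib]
    refine Finset.sum_congr rfl fun j _ => ?_
    have := self_mul_sign (α j : ℝ)
    rw [← this]; ring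
  rw [e] at hα
  exact hα.trans ((le_abs_self _).trans (Finset.single_le_sum (f := fun σ => |C σ|)
    (fun _ _ => abs_nonneg _) (Finset.mem_univ _)))

/-- A Laurent series with exponentially decaying terms at `x` is holomorphic near the points with
logarithmic coordinates `x`, and even up to the hyperplanes `z j = 0`, `j ∈ J`, if only
non-negative powers of these `z j` occur. -/
theorem ExpDecay.exists_differentiableAt_tsum {n : ℕ} {a : (Fin n → ℤ) → ℂ} {x : Fin n → ℝ}
    (h : ExpDecay a x) (J : Set (Fin n)) (hJ : ∀ α, ∀ j ∈ J, a α ≠ 0 → 0 ≤ α j) :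
    ∃ ε > 0, ∀ z : Fin n → ℂ,
      (∀ j, ‖z j‖ < Real.exp (x j + ε) ∧ (j ∉ J → Real.exp (x j - ε) < ‖z j‖)) →
      DifferentiableAt ℂ (fun z => ∑' α, a α * laurentMonomial α z) z := by
  obtain ⟨ε, hε, M, hM⟩ := h
  refine ⟨ε / 2, by positivity, ?_⟩
  have hU : IsOpen {z : Fin n → ℂ | ∀ j, ‖z j‖ < Real.exp (x j + ε / 2) ∧
      (j ∉ J → Real.exp (x j - ε / 2) < ‖z j‖)} := by
    simp only [ofPred_forall]
    refine isOpen_iInter_of_finite fun j => ?_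
    have h2 : IsOpen {z : Fin n → ℂ | j ∉ J → Real.exp (x j - ε / 2) < ‖z j‖} := by
      by_cases hj : j ∈ J
      · have : {z : Fin n → ℂ | j ∉ J → Real.exp (x j - ε / 2) < ‖z j‖} = univ := by ext; simp [hj]
        rw [this]; exact isOpen_univ
      · have : {z : Fin n → ℂ | j ∉ J → Real.exp (x j - ε / 2) < ‖z j‖}
            = {z | Real.exp (x j - ε / 2) < ‖z j‖} := by ext; simp [hj]
        rw [this]; exact isOpen_lt continuous_const (continuous_apply j).norm
    exact (isOpen_lt (continuous_apply j).norm continuous_const).inter h2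
  have hsum := (summable_exp_neg_sum_abs n (half_pos hε)).mul_left M
  have hsgn : ∀ α, a α ≠ 0 → ∀ z ∈ {z : Fin n → ℂ | ∀ j, ‖z j‖ < Real.exp (x j + ε / 2) ∧
      (j ∉ J → Real.exp (x j - ε / 2) < ‖z j‖)}, ∀ j, z j ≠ 0 ∨ 0 ≤ α j := by
    intro α hα z hz j
    by_cases hj : j ∈ J
    · exact Or.inr (hJ α j hj hα)
    · exact Or.inl (norm_pos_iff.1 ((Real.exp_pos _).trans ((hz j).2 hj)))
  refine fun z hz => (differentiableOn_tsum_of_norm_le hU hsum (fun α z hz => ?_)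
    fun α z hz => ?_).differentiableAt (hU.mem_nhds hz)
  · by_cases hα : a α = 0
    · simp only [hα, zero_mul]; fun_prop
    · exact ((differentiableAt_laurentMonomial (hsgn α hα z hz)).const_mul _).differentiableWithinAt
  · by_cases hα : a α = 0
    · have hM0 : 0 ≤ M := (by positivity : (0 : ℝ) ≤ _).trans (hM 0)
      rw [hα, zero_mul, norm_zero]; positivity
    have hz' := hz
    have hfac : ∀ j, ‖z j ^ α j‖ ≤ Real.exp (α j * x j + ε / 2 * |(α j : ℝ)|) := by
      intro j
      rcases hsgn α hα z hz j with hj | hj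
      · have hpos := norm_pos_iff.2 hj
        by_cases hα0 : 0 ≤ α j
        · have h0 : (0 : ℝ) ≤ α j := by exact_mod_cast hα0
          have h1 : Real.log ‖z j‖ ≤ x j + ε / 2 := (Real.log_le_iff_le_exp hpos).2 (hz' j).1.le
          rw [norm_zpow, ← Real.rpow_intCast, Real.rpow_def_of_pos hpos, abs_of_nonneg h0]
          exact Real.exp_le_exp.2 (by nlinarith)
        · have hjJ : j ∉ J := fun hjJ => hα0 (hJ α j hjJ hα)
          have h0 : (α j : ℝ) < 0 := by exact_mod_cast not_le.1 hα0
          have h1 : x j - ε / 2 ≤ Real.log ‖z j‖ :=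
            (Real.le_log_iff_exp_le hpos).2 ((hz' j).2 hjJ).le
          rw [norm_zpow, ← Real.rpow_intCast, Real.rpow_def_of_pos hpos, abs_of_neg h0]
          exact Real.exp_le_exp.2 (by nlinarith)
      · obtain ⟨m, hm⟩ := Int.eq_ofNat_of_zero_le hj
        rw [hm]
        simp only [zpow_natCast, norm_pow, Int.cast_natCast, Nat.abs_cast]
        calc ‖z j‖ ^ m ≤ Real.exp (x j + ε / 2) ^ m :=
              pow_le_pow_left₀ (norm_nonneg _) (hz' j).1.le m
          _ = _ := by rw [← Real.exp_nat_mul]; ring_nf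
    calc ‖a α * laurentMonomial α z‖ ≤ ‖a α‖ * ∏ j, Real.exp (α j * x j + ε / 2 * |(α j : ℝ)|) := by
          rw [norm_mul, laurentMonomial, norm_prod]
          exact mul_le_mul_of_nonneg_left (Finset.prod_le_prod (fun _ _ => norm_nonneg _)
            fun j _ => hfac j) (norm_nonneg _)
      _ = ‖a α‖ * Real.exp (∑ j, α j * x j + ε * ∑ j, |(α j : ℝ)|)
          * Real.exp (-(ε / 2 * ∑ j, |(α j : ℝ)|)) := by
          rw [← Real.exp_sum, mul_assoc, ← Real.exp_add, Finset.sum_add_distrib, ← Finset.mul_sum]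
          ring_nf
      _ ≤ _ := mul_le_mul_of_nonneg_right (hM α) (Real.exp_pos _).le

/-! ### Convexity of the logarithmic image -/

theorem IsNCircled.laurent_tsum_eq {n : ℕ} {G : Set (Fin n → ℂ)} (hG : IsOpen G)
    (hc : IsNCircled G) {f : (Fin n → ℂ) → ℂ} (hf : DifferentiableOn ℂ f G)
    {a : (Fin n → ℤ) → ℂ} (ha : HasLaurentCoeff f (logImage G) a) {z : Fin n → ℂ} (hz : z ∈ G)
    (h0 : ∀ j, z j ≠ 0) : ∑' α, a α * laurentMonomial α z = f z := by
  obtain ⟨t, ht⟩ := exists_polarPoint_eq z h0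
  have hx := (hc.logAbs_mem_iff h0).2 hz
  have hcont : ∀ x ∈ logImage G, Continuous fun t => f (polarPoint x t) := fun x hx =>
    continuous_comp_polarPoint (differentiableAt_of_logAbs_mem hG hc hf) hx
  have := ha.tsum_eq hx (hcont _ hx) (ha.expDecay (isOpen_logImage hG) hcont hx).summable t
  rwa [ht] at this

theorem isDomainCn_ball {n : ℕ} (z : Fin n → ℂ) {r : ℝ} (hr : 0 < r) :
    IsDomainCn (Metric.ball z r) :=
  ⟨Metric.isOpen_ball, (convex_ball z r).isConnected (Metric.nonempty_ball.2 hr)⟩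

theorem IsDomainCn.exists_ball_subset {n : ℕ} {G : Set (Fin n → ℂ)} (hG : IsDomainCn G) :
    ∃ z r, 0 < r ∧ Metric.ball z r ⊆ G ∧ ∀ w ∈ Metric.ball z r, ∀ j, w j ≠ 0 := by
  obtain ⟨z, hz, h0⟩ := hG.exists_mem_forall_ne_zero
  obtain ⟨r, hr, hb⟩ := Metric.isOpen_iff.1 (hG.1.inter (isOpen_forall_ne_zero n)) z ⟨hz, h0⟩
  exact ⟨z, r, hr, fun w hw => (hb hw).1, fun w hw => (hb hw).2⟩

/-- The Laurent series of every holomorphic function on `G` converges on the points whose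
logarithmic coordinates lie in the convex hull of `logImage G`. -/
theorem IsDomainOfHolomorphy.convex_logImage {n : ℕ} {G : Set (Fin n → ℂ)}
    (hG : IsDomainOfHolomorphy G) (hc : IsNCircled G) : Convex ℝ (logImage G) := by
  obtain ⟨hdom, hno⟩ := hG
  have hopen := isOpen_logImage hdom.1
  rw [← convexHull_eq_self]
  refine Subset.antisymm (fun x hx => ?_) (subset_convexHull ℝ _)
  by_contra hxX
  apply hno
  obtain ⟨z₀, r, hr, hb, hb0⟩ := hdom.exists_ball_subset
  refine ⟨Metric.ball z₀ r, {z | (∀ j, z j ≠ 0) ∧ logAbs z ∈ convexHull ℝ (logImage G)},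
    isDomainCn_ball z₀ hr, ⟨?_, ?_⟩, fun w hw => ⟨hb hw, hb0 w hw,
      subset_convexHull ℝ _ ((hc.logAbs_mem_iff (hb0 w hw)).2 (hb hw))⟩, fun hsub => ?_, ?_⟩
  · have hco : ContinuousOn logAbs {z : Fin n → ℂ | ∀ j, z j ≠ 0} :=
      fun z hz => (continuousAt_logAbs hz).continuousWithinAt
    exact hco.isOpen_inter_preimage (isOpen_forall_ne_zero n) hopen.convexHull
  · have himg : {z : Fin n → ℂ | (∀ j, z j ≠ 0) ∧ logAbs z ∈ convexHull ℝ (logImage G)}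
        = (fun q : (Fin n → ℝ) × UnitAddTorus (Fin n) => polarPoint q.1 q.2) ''
          (convexHull ℝ (logImage G) ×ˢ univ) := by
      ext z
      constructor
      · rintro ⟨h0, hz⟩
        obtain ⟨t, ht⟩ := exists_polarPoint_eq z h0
        exact ⟨(logAbs z, t), ⟨hz, mem_univ _⟩, ht⟩
      · rintro ⟨⟨y, t⟩, ⟨hy, -⟩, rfl⟩
        exact ⟨polarPoint_ne_zero y t, by rwa [logAbs_polarPoint]⟩
    rw [himg]
    refine IsConnected.image (IsConnected.prod ?_ isConnected_univ)
      _ continuous_polarPoint.continuousOn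
    exact (convex_convexHull ℝ _).isConnected (nonempty_logImage hdom hc).convexHull
  · have : polarPoint x 0 ∈ G :=
      hsub ⟨polarPoint_ne_zero x 0, by rwa [logAbs_polarPoint]⟩
    exact hxX (hc.polarPoint_mem_iff.1 this)
  · intro f hf
    obtain ⟨a, ha⟩ := exists_hasLaurentCoeff hdom hc hf
    refine ⟨fun z => ∑' α, a α * laurentMonomial α z, fun z hz => ?_, fun w hw =>
      hc.laurent_tsum_eq hdom.1 hf ha (hb hw) (hb0 w hw)⟩
    have hdec : ExpDecay a (logAbs z) := convexHull_min (fun y hy =>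
      ha.expDecay hopen (fun y hy => continuous_comp_polarPoint
        (differentiableAt_of_logAbs_mem hdom.1 hc hf) hy) hy) (convex_setOf_expDecay a) hz.2
    obtain ⟨ε, hε, hd⟩ := hdec.exists_differentiableAt_tsum ∅ (by simp)
    refine (hd z fun j => ?_).differentiableWithinAt
    have hj := norm_pos_iff.2 (hz.1 j)
    exact ⟨(Real.log_lt_iff_lt_exp hj).1 (by simp only [logAbs]; linarith), fun _ =>
      (Real.lt_log_iff_exp_lt hj).1 (by simp only [logAbs]; linarith)⟩

/-! ### Bounded functions extend to the interior of the closure -/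

theorem sum_mul_update {n : ℕ} (c x : Fin n → ℝ) (j : Fin n) (s : ℝ) :
    ∑ i, c i * Function.update x j s i = ∑ i, c i * x i + c j * (s - x j) := by
  rw [← sub_eq_iff_eq_add', ← Finset.sum_sub_distrib, Finset.sum_eq_single j]
  · rw [Function.update_self]; ring
  · intro i _ hi; rw [Function.update_of_ne hi]; ring
  · simp

/-- Where the interior of the closure meets a hyperplane `z j = 0`, boundedness rules out negative
powers of `z j` in the Laurent series, which then converges near that hyperplane. -/
theorem exists_extension_interior_closure {n : ℕ} {G : Set (Fin n → ℂ)} (hG : IsDomainCn G)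
    (hc : IsNCircled G) (hX : Convex ℝ (logImage G)) {f : (Fin n → ℂ) → ℂ}
    (hf : DifferentiableOn ℂ f G) {C : ℝ} (hC : ∀ z ∈ G, ‖f z‖ ≤ C) :
    ∃ g, DifferentiableOn ℂ g (interior (closure G)) ∧
      ∀ z ∈ G, (∀ j, z j ≠ 0) → g z = f z := by
  obtain ⟨a, ha⟩ := exists_hasLaurentCoeff hG hc hf
  refine ⟨fun z => ∑' α, a α * laurentMonomial α z, fun z hz => ?_, fun w hw h0 =>
    hc.laurent_tsum_eq hG.1 hf ha hw h0⟩
  obtain ⟨ρ, hρ, hb⟩ := Metric.isOpen_iff.1 isOpen_interior z hz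
  have hmem : ∀ w ∈ Metric.ball z ρ, (∀ j, w j ≠ 0) → logAbs w ∈ logImage G := fun w hw h0 =>
    (hc.logAbs_mem_iff h0).2 (mem_of_mem_interior_closure hG.1 hc hX (hb hw) h0)
  let w : Fin n → ℂ := fun j => if z j = 0 then ((ρ / 2 : ℝ) : ℂ) else z j
  have hρ2 : ‖((ρ / 2 : ℝ) : ℂ)‖ = ρ / 2 := by
    rw [Complex.norm_real, Real.norm_eq_abs, abs_of_pos (half_pos hρ)]
  have hwb : ∀ j, dist (w j) (z j) < ρ := fun j => by
    by_cases hj : z j = 0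
    · simp only [w, hj, if_true, dist_zero_right, hρ2]; linarith
    · simpa [w, hj] using hρ
  have hw0 : ∀ j, w j ≠ 0 := fun j => by
    by_cases hj : z j = 0
    · rw [← norm_pos_iff]; simp only [w, hj, if_true, hρ2]; linarith
    · simp [w, hj]
  have hwX := hmem w ((dist_pi_lt_iff hρ).2 hwb) hw0
  have hdec : ExpDecay a (logAbs w) := ha.expDecay (isOpen_logImage hG.1)
    (fun y hy => continuous_comp_polarPoint (differentiableAt_of_logAbs_mem hG.1 hc hf) hy) hwX
  obtain ⟨ε, hε, hd⟩ := hdec.exists_differentiableAt_tsum {j | z j = 0} (by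
    intro α j hj hα
    by_contra hneg
    have hneg' : (α j : ℝ) ≤ -1 := by
      have : α j ≤ -1 := by omega
      exact_mod_cast this
    have hpos := norm_pos_iff.2 hα
    -- move the `j`-th logarithmic coordinate to `-∞`
    have key : ∀ s ≤ Real.log (ρ / 2),
        ‖a α‖ * Real.exp (∑ i, α i * logAbs w i + α j * (s - logAbs w j)) ≤ C := by
      intro s hs
      have hes : ‖((Real.exp s : ℝ) : ℂ)‖ = Real.exp s := by
        rw [Complex.norm_real, Real.norm_eq_abs, abs_of_pos (Real.exp_pos s)]
      have h0 : ∀ i, Function.update w j ((Real.exp s : ℝ) : ℂ) i ≠ 0 := fun i => by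
        rcases eq_or_ne i j with rfl | hi
        · rw [Function.update_self, ← norm_pos_iff, hes]; exact Real.exp_pos s
        · rw [Function.update_of_ne hi]; exact hw0 i
      have hm := hmem (Function.update w j ((Real.exp s : ℝ) : ℂ))
        ((dist_pi_lt_iff hρ).2 fun i => by
          rcases eq_or_ne i j with rfl | hi
          · have hz0 : z i = 0 := hj
            rw [Function.update_self, hz0, dist_zero_right, hes]
            have := (Real.le_log_iff_exp_le (half_pos hρ)).1 hs
            linarith
          · rw [Function.update_of_ne hi]; exact hwb i) h0
      have hlog : logAbs (Function.update w j ((Real.exp s : ℝ) : ℂ))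
          = Function.update (logAbs w) j s := by
        funext i
        rcases eq_or_ne i j with rfl | hi
        · simp only [logAbs, Function.update_self, hes, Real.log_exp]
        · simp only [logAbs, Function.update_of_ne hi]
      rw [hlog] at hm
      have := ha.norm_le hm (fun t => hC _ (hc.polarPoint_mem_iff.2 hm)) α
      rwa [sum_mul_update (fun i => (α i : ℝ))] at this
    have h1 := key (min (Real.log (ρ / 2)) (logAbs w j - |C| / ‖a α‖
      - |∑ i, α i * logAbs w i|)) (min_le_left _ _)
    have h2 : min (Real.log (ρ / 2)) (logAbs w j - |C| / ‖a α‖ - |∑ i, α i * logAbs w i|)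
      - logAbs w j ≤ -(|C| / ‖a α‖ + |∑ i, α i * logAbs w i|) := by
      have := min_le_right (Real.log (ρ / 2))
        (logAbs w j - |C| / ‖a α‖ - |∑ i, α i * logAbs w i|)
      linarith
    set D := min (Real.log (ρ / 2)) (logAbs w j - |C| / ‖a α‖ - |∑ i, α i * logAbs w i|)
      - logAbs w j
    have h3 : 0 ≤ |C| / ‖a α‖ := by positivity
    have h4 := abs_nonneg (∑ i, α i * logAbs w i)
    have h5 : |C| / ‖a α‖ ≤ ∑ i, α i * logAbs w i + α j * D := by
      have := neg_abs_le (∑ i, α i * logAbs w i)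
      nlinarith
    have h6 := Real.add_one_le_exp (∑ i, α i * logAbs w i + α j * D)
    have h7 : ‖a α‖ * (|C| / ‖a α‖ + 1) ≤ C :=
      (mul_le_mul_of_nonneg_left (by linarith) hpos.le).trans h1
    rw [mul_add, mul_div_cancel₀ _ hpos.ne', mul_one] at h7
    linarith [le_abs_self C])
  refine (hd z fun j => ?_).differentiableWithinAt
  by_cases hj : z j = 0
  · refine ⟨?_, fun h => absurd hj h⟩
    rw [hj, norm_zero]; exact Real.exp_pos _
  · have hw : logAbs w j = Real.log ‖z j‖ := by simp [logAbs, w, hj]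
    have hjp := norm_pos_iff.2 hj
    rw [hw]
    exact ⟨(Real.log_lt_iff_lt_exp hjp).1 (by linarith), fun _ =>
      (Real.lt_log_iff_exp_lt hjp).1 (by linarith)⟩

theorem norm_le_of_memLp_top {n : ℕ} {G : Set (Fin n → ℂ)} (hG : IsOpen G)
    {f : (Fin n → ℂ) → ℂ} (hf : ContinuousOn f G) (hp : MemLp f ∞ (volume.restrict G)) :
    ∃ C, ∀ z ∈ G, ‖f z‖ ≤ C := by
  refine ⟨(eLpNorm f ∞ (volume.restrict G)).toReal, fun z hz => ?_⟩
  by_contra hlt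
  rw [not_le] at hlt
  have hopen : IsOpen (G ∩ {w | (eLpNorm f ∞ (volume.restrict G)).toReal < ‖f w‖}) :=
    hf.norm.isOpen_inter_preimage hG isOpen_Ioi
  have hae : ∀ᵐ w ∂(volume.restrict G), ‖f w‖ ≤ (eLpNorm f ∞ (volume.restrict G)).toReal := by
    rw [eLpNorm_exponent_top]
    filter_upwards [ae_le_eLpNormEssSup (f := f) (μ := volume.restrict G)] with w hw
    have hfin : eLpNormEssSup f (volume.restrict G) ≠ ∞ := by
      have := hp.eLpNorm_ne_top; rwa [eLpNorm_exponent_top] at this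
    have := (ENNReal.toReal_le_toReal (enorm_ne_top) hfin).2 hw
    simpa using this
  rw [ae_restrict_iff' hG.measurableSet] at hae
  refine hopen.measure_pos volume ⟨z, hz, hlt⟩ |>.ne' ?_
  refine measure_mono_null (fun w hw => ?_) hae
  exact fun h => absurd (h hw.1) (not_le.2 hw.2)

theorem multiPartial_zero {n : ℕ} (f : (Fin n → ℂ) → ℂ) : multiPartial 0 f = f := by
  unfold multiPartial
  induction List.finRange n with
  | nil => rfl
  | cons j l ih => exact ih

/-- A domain of holomorphy for a family of bounded functions is fat. -/
theorem isFat_of_isDomainOfHolomorphyFor {n : ℕ} {G : Set (Fin n → ℂ)} (hc : IsNCircled G)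
    (hX : Convex ℝ (logImage G)) {F : Set ((Fin n → ℂ) → ℂ)} (hG : IsDomainOfHolomorphyFor F G)
    (hF : ∀ f ∈ F, DifferentiableOn ℂ f G ∧ ∃ C, ∀ z ∈ G, ‖f z‖ ≤ C) : IsFat G := by
  obtain ⟨hdom, hno⟩ := hG
  have hsub : G ⊆ interior (closure G) := interior_maximal subset_closure hdom.1
  refine Subset.antisymm hsub ?_
  by_contra hnot
  apply hno
  obtain ⟨z₀, r, hr, hb, hb0⟩ := hdom.exists_ball_subset
  refine ⟨Metric.ball z₀ r, interior (closure G), isDomainCn_ball z₀ hr, ⟨isOpen_interior,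
    hdom.2.subset_closure hsub interior_subset⟩, fun w hw => ⟨hb hw, hsub (hb hw)⟩, hnot,
    fun f hf => ?_⟩
  obtain ⟨hd, C, hC⟩ := hF f hf
  obtain ⟨g, hg, hgf⟩ := exists_extension_interior_closure hdom hc hX hd hC
  exact ⟨g, hg, fun w hw => hgf w (hb hw) (hb0 w hw)⟩

/-! ### Integrable functions exclude directions of invariance -/

theorem polarPoint_add {n : ℕ} (x : Fin n → ℝ) (t s : UnitAddTorus (Fin n)) :
    polarPoint x (t + s) = fun j => ((t j).toCircle : ℂ) * polarPoint x s j := by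
  funext j
  simp only [polarPoint, Pi.add_apply, AddCircle.toCircle_add, Circle.coe_mul]
  ring

theorem measurePreserving_rotation {n : ℕ} (t : UnitAddTorus (Fin n)) :
    MeasurePreserving (fun z : Fin n → ℂ => fun j => ((t j).toCircle : ℂ) * z j) :=
  volume_preserving_pi fun j => (rotation (t j).toCircle).measurePreserving

/-- Jensen's inequality bounds a Laurent term by the mean of `|f| ^ p` over a torus. -/
theorem HasLaurentCoeff.enorm_rpow_le {n : ℕ} {f : (Fin n → ℂ) → ℂ} {X : Set (Fin n → ℝ)}
    {a : (Fin n → ℤ) → ℂ} (h : HasLaurentCoeff f X a) {p : ℝ≥0∞} (hp : 1 ≤ p) (hp' : p ≠ ∞)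
    {z : Fin n → ℂ} (h0 : ∀ j, z j ≠ 0) (hz : logAbs z ∈ X)
    (hf : Continuous fun t => f (polarPoint (logAbs z) t)) (α : Fin n → ℤ) :
    ‖a α * laurentMonomial α z‖ₑ ^ p.toReal
      ≤ ∫⁻ t, ‖f (fun j => ((t j).toCircle : ℂ) * z j)‖ₑ ^ p.toReal ∂(torusMeasure n) := by
  obtain ⟨t₀, ht₀⟩ := exists_polarPoint_eq z h0
  have e1 : ‖a α * laurentMonomial α z‖ₑ
      = ‖UnitAddTorus.mFourierCoeff (fun t => f (polarPoint (logAbs z) t)) α‖ₑ := by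
    rw [h _ hz α, ← ofReal_norm, ← ofReal_norm, norm_mul, norm_mul, norm_laurentMonomial α h0,
      Complex.norm_real, Real.norm_eq_abs, abs_of_pos (Real.exp_pos _)]
  have hp0 : 0 < p.toReal := ENNReal.toReal_pos (by positivity) hp'
  have e2 : ‖UnitAddTorus.mFourierCoeff (fun t => f (polarPoint (logAbs z) t)) α‖ₑ
      ≤ eLpNorm (fun t => f (polarPoint (logAbs z) t)) p (torusMeasure n) := by
    refine le_trans ?_ (eLpNorm_le_eLpNorm_of_exponent_le hp hf.aestronglyMeasurable)
    rw [eLpNorm_one_eq_lintegral_enorm]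
    refine (enorm_integral_le_lintegral_enorm _).trans (lintegral_mono fun t => ?_)
    have : ‖UnitAddTorus.mFourier (-α) t‖ ≤ 1 :=
      ((UnitAddTorus.mFourier (-α)).norm_coe_le_norm t).trans_eq UnitAddTorus.mFourier_norm
    have h1 : ‖UnitAddTorus.mFourier (-α) t‖ₑ ≤ 1 := by
      rw [← ofReal_norm]; exact ENNReal.ofReal_le_one.2 this
    rw [smul_eq_mul, enorm_mul]
    exact mul_le_of_le_one_left' h1
  have e3 : eLpNorm (fun t => f (polarPoint (logAbs z) t)) p (torusMeasure n) ^ p.toReal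
      = ∫⁻ t, ‖f (polarPoint (logAbs z) t)‖ₑ ^ p.toReal ∂(torusMeasure n) := by
    rw [eLpNorm_eq_lintegral_rpow_enorm_toReal (by positivity) hp', ← ENNReal.rpow_mul,
      one_div_mul_cancel hp0.ne', ENNReal.rpow_one]
  have e4 := lintegral_add_right_eq_self (μ := torusMeasure n)
    (fun t => ‖f (polarPoint (logAbs z) t)‖ₑ ^ p.toReal) t₀
  simp only [polarPoint_add, ht₀] at e4
  rw [e4, ← e3, e1]
  exact ENNReal.rpow_le_rpow e2 hp0.le

/-- By Tonelli's theorem and rotation invariance, every monomial in the Laurent series of an `L^p`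
function is itself `L^p`. -/
theorem lintegral_laurentMonomial_lt_top {n : ℕ} {G : Set (Fin n → ℂ)} (hG : IsOpen G)
    (hc : IsNCircled G) {f : (Fin n → ℂ) → ℂ} (hf : DifferentiableOn ℂ f G) {p : ℝ≥0∞}
    (hp : 1 ≤ p) (hp' : p ≠ ∞) (hfp : MemLp f p (volume.restrict G)) {a : (Fin n → ℤ) → ℂ}
    (ha : HasLaurentCoeff f (logImage G) a) {α : Fin n → ℤ} (hα : a α ≠ 0) :
    ∫⁻ z in G ∩ {z | ∀ j, z j ≠ 0}, ‖laurentMonomial α z‖ₑ ^ p.toReal < ∞ := by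
  classical
  have hp0 : 0 < p.toReal := ENNReal.toReal_pos (by positivity) hp'
  have hmeas : Measurable (G.indicator f) := by
    have := hf.continuousOn.measurable_piecewise (g := fun _ => (0 : ℂ)) continuousOn_const
      hG.measurableSet
    rwa [← Set.piecewise_eq_indicator]
  have hrot : Measurable fun q : (Fin n → ℂ) × UnitAddTorus (Fin n) =>
      (fun j => ((q.2 j).toCircle : ℂ) * q.1 j) := by
    refine measurable_pi_lambda _ fun j => Measurable.mul ?_ ?_
    · exact (continuous_subtype_val.comp AddCircle.continuous_toCircle).measurable.comp
        ((measurable_pi_apply j).comp measurable_snd)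
    · exact (measurable_pi_apply j).comp measurable_fst
  have hjoint : Measurable fun q : (Fin n → ℂ) × UnitAddTorus (Fin n) =>
      ‖G.indicator f (fun j => ((q.2 j).toCircle : ℂ) * q.1 j)‖ₑ ^ p.toReal :=
    (hmeas.comp hrot).enorm.pow_const _
  have hswap := lintegral_lintegral_swap (μ := (volume : Measure (Fin n → ℂ)))
    (ν := torusMeasure n) (f := fun (z : Fin n → ℂ) (t : UnitAddTorus (Fin n)) =>
      ‖G.indicator f (fun j => ((t j).toCircle : ℂ) * z j)‖ₑ ^ p.toReal) hjoint.aemeasurable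
  have hbound : ∀ z ∈ G ∩ {z | ∀ j, z j ≠ 0}, ‖a α‖ₑ ^ p.toReal * ‖laurentMonomial α z‖ₑ ^ p.toReal
      ≤ ∫⁻ t, ‖G.indicator f (fun j => ((t j).toCircle : ℂ) * z j)‖ₑ ^ p.toReal
        ∂(torusMeasure n) := by
    rintro z ⟨hz, h0⟩
    have hx := (hc.logAbs_mem_iff h0).2 hz
    have := ha.enorm_rpow_le hp hp' h0 hx (continuous_comp_polarPoint
      (differentiableAt_of_logAbs_mem hG hc hf) hx) α
    rw [enorm_mul, ENNReal.mul_rpow_of_nonneg _ _ hp0.le] at this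
    refine this.trans_eq (lintegral_congr fun t => ?_)
    rw [indicator_of_mem (hc.mem_of_norm_eq hz fun j => by
      rw [norm_mul, Circle.norm_coe, one_mul])]
  have hfin : ∫⁻ z, ‖G.indicator f z‖ₑ ^ p.toReal < ∞ := by
    have h1 := lintegral_rpow_enorm_lt_top_of_eLpNorm_lt_top (by positivity) hp' hfp.2
    have h2 : (fun z => ‖G.indicator f z‖ₑ ^ p.toReal)
        = G.indicator fun z => ‖f z‖ₑ ^ p.toReal := by
      funext z
      by_cases hz : z ∈ G
      · simp [hz]
      · simp [hz, hp0]
    rwa [h2, lintegral_indicator hG.measurableSet]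
  have hnorm : Measurable fun z : Fin n → ℂ => ‖G.indicator f z‖ₑ ^ p.toReal :=
    hmeas.enorm.pow_const _
  have hinv : ∀ t : UnitAddTorus (Fin n),
      ∫⁻ z : Fin n → ℂ, ‖G.indicator f (fun j => ((t j).toCircle : ℂ) * z j)‖ₑ ^ p.toReal
        = ∫⁻ z : Fin n → ℂ, ‖G.indicator f z‖ₑ ^ p.toReal := fun t =>
    (measurePreserving_rotation t).lintegral_comp hnorm
  have hle : ‖a α‖ₑ ^ p.toReal * ∫⁻ (z : Fin n → ℂ) in G ∩ {z | ∀ j, z j ≠ 0},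
      ‖laurentMonomial α z‖ₑ ^ p.toReal ≤ ∫⁻ (z : Fin n → ℂ), ‖G.indicator f z‖ₑ ^ p.toReal := by
    calc _ ≤ ∫⁻ (z : Fin n → ℂ) in G ∩ {z | ∀ j, z j ≠ 0},
          ‖a α‖ₑ ^ p.toReal * ‖laurentMonomial α z‖ₑ ^ p.toReal := lintegral_const_mul_le _ _
      _ ≤ ∫⁻ (z : Fin n → ℂ) in G ∩ {z | ∀ j, z j ≠ 0}, ∫⁻ (t : UnitAddTorus (Fin n)),
          ‖G.indicator f (fun j => ((t j).toCircle : ℂ) * z j)‖ₑ ^ p.toReal ∂(torusMeasure n) :=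
        setLIntegral_mono' (hG.inter (isOpen_forall_ne_zero n)).measurableSet hbound
      _ ≤ ∫⁻ (z : Fin n → ℂ), ∫⁻ (t : UnitAddTorus (Fin n)),
          ‖G.indicator f (fun j => ((t j).toCircle : ℂ) * z j)‖ₑ ^ p.toReal ∂(torusMeasure n) :=
        lintegral_mono' Measure.restrict_le_self le_rfl
      _ = ∫⁻ (t : UnitAddTorus (Fin n)), ∫⁻ (z : Fin n → ℂ),
          ‖G.indicator f (fun j => ((t j).toCircle : ℂ) * z j)‖ₑ ^ p.toReal
          ∂volume ∂(torusMeasure n) :=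
        hswap
      _ = ∫⁻ (t : UnitAddTorus (Fin n)), ∫⁻ (z : Fin n → ℂ),
          ‖G.indicator f z‖ₑ ^ p.toReal ∂volume ∂(torusMeasure n) := by
        exact lintegral_congr hinv
      _ = _ := by rw [lintegral_const, measure_univ, mul_one]
  have ha0 : ‖a α‖ₑ ^ p.toReal ≠ 0 := by
    simp [ENNReal.rpow_eq_zero_iff, hα]
  by_contra htop
  rw [not_lt, top_le_iff] at htop
  rw [htop, ENNReal.mul_top ha0, top_le_iff] at hle
  exact hfin.ne hle

/-- A product of discs around the positive point with logarithmic coordinates `y`, with radii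
proportional to the coordinates of their centres. -/
def relativePolydisc {n : ℕ} (ε : ℝ) (y : Fin n → ℝ) : Set (Fin n → ℂ) :=
  Set.pi univ fun j => Metric.ball (Real.exp (y j) : ℂ) ((1 - Real.exp (-ε)) * Real.exp (y j))

theorem abs_log_sub_le_of_mem_relativePolydisc {n : ℕ} {ε : ℝ} {y : Fin n → ℝ}
    {z : Fin n → ℂ} (hz : z ∈ relativePolydisc ε y) (j : Fin n) :
    z j ≠ 0 ∧ |logAbs z j - y j| ≤ ε := by
  have h := hz j (mem_univ j)
  rw [Metric.mem_ball, dist_eq_norm] at h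
  have h1 := abs_le.1 (abs_norm_sub_norm_le (z j) (Real.exp (y j) : ℂ))
  rw [Complex.norm_real, Real.norm_eq_abs, abs_of_pos (Real.exp_pos _)] at h1
  have hy := Real.exp_pos (y j)
  have hlow : Real.exp (y j - ε) < ‖z j‖ := by
    rw [sub_eq_add_neg, Real.exp_add]; nlinarith
  have hup : ‖z j‖ < Real.exp (y j + ε) := by
    rw [Real.exp_add]
    have := Real.add_one_le_exp ε
    have := Real.add_one_le_exp (-ε)
    nlinarith
  have hpos : 0 < ‖z j‖ := (Real.exp_pos _).trans hlow
  refine ⟨norm_pos_iff.1 hpos, abs_le.2 ⟨?_, ?_⟩⟩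
  · have := (Real.lt_log_iff_exp_lt hpos).2 hlow
    simp only [logAbs]; linarith
  · have := (Real.log_lt_iff_lt_exp hpos).2 hup
    simp only [logAbs]; linarith

theorem lintegral_relativePolydisc_ge {n : ℕ} {ε : ℝ} (hε : 0 < ε) {P : ℝ} (hP : 0 < P)
    (α : Fin n → ℤ) (y : Fin n → ℝ) :
    ENNReal.ofReal (Real.exp (∑ j, (P * α j + 2) * y j)
      * (Real.exp (-(P * (ε * ∑ j, |(α j : ℝ)|))) * ((1 - Real.exp (-ε)) ^ 2 * Real.pi) ^ n))
      ≤ ∫⁻ z in relativePolydisc ε y, ‖laurentMonomial α z‖ₑ ^ P := by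
  have hδ : 0 < 1 - Real.exp (-ε) := by
    have := Real.exp_lt_exp.2 (neg_lt_zero.2 hε)
    rw [Real.exp_zero] at this; linarith
  have hmeas : MeasurableSet (relativePolydisc ε y) :=
    MeasurableSet.univ_pi fun j => measurableSet_ball
  have hvol : volume (relativePolydisc ε y)
      = ENNReal.ofReal (∏ j, (((1 - Real.exp (-ε)) * Real.exp (y j)) ^ 2 * Real.pi)) := by
    rw [relativePolydisc, volume_pi_pi, ENNReal.ofReal_prod_of_nonneg fun j _ => by positivity]
    refine Finset.prod_congr rfl fun j _ => ?_
    rw [Complex.volume_ball, ENNReal.ofReal_mul (q := Real.pi) (by positivity),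
      ENNReal.ofReal_pow (by positivity)]
    congr 1
    rw [ENNReal.ofReal, Real.toNNReal_of_nonneg Real.pi_pos.le]; rfl
  calc _ = ENNReal.ofReal (Real.exp (∑ j, α j * y j - ε * ∑ j, |(α j : ℝ)|)) ^ P
        * volume (relativePolydisc ε y) := by
        rw [hvol, ENNReal.ofReal_rpow_of_pos (Real.exp_pos _), ← ENNReal.ofReal_mul (by positivity),
          ← Real.exp_mul]
        congr 1
        have e1 : ∏ j, (((1 - Real.exp (-ε)) * Real.exp (y j)) ^ 2 * Real.pi)
            = ((1 - Real.exp (-ε)) ^ 2 * Real.pi) ^ n * Real.exp (∑ j, 2 * y j) := by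
          rw [Real.exp_sum]
          have : ∀ j, ((1 - Real.exp (-ε)) * Real.exp (y j)) ^ 2 * Real.pi
              = ((1 - Real.exp (-ε)) ^ 2 * Real.pi) * Real.exp (2 * y j) := fun j => by
            rw [mul_pow, ← Real.exp_nat_mul]; push_cast; ring
          rw [Finset.prod_congr rfl fun j _ => this j, Finset.prod_mul_distrib, Finset.prod_const,
            Finset.card_univ, Fintype.card_fin]
        rw [e1]
        have e2 : ∑ j, (P * α j + 2) * y j = P * ∑ j, α j * y j + ∑ j, 2 * y j := by
          rw [Finset.mul_sum, ← Finset.sum_add_distrib]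
          exact Finset.sum_congr rfl fun j _ => by ring
        rw [e2, ← mul_assoc, ← Real.exp_add, mul_comm (_ ^ n) (Real.exp (∑ j, 2 * y j)),
          ← mul_assoc (Real.exp _) (Real.exp _), ← Real.exp_add]
        ring_nf
    _ = ∫⁻ _ in relativePolydisc ε y,
        ENNReal.ofReal (Real.exp (∑ j, α j * y j - ε * ∑ j, |(α j : ℝ)|)) ^ P := by
        rw [setLIntegral_const]
    _ ≤ _ := by
        refine setLIntegral_mono' hmeas fun z hz => ENNReal.rpow_le_rpow ?_ hP.le
        have hz' := abs_log_sub_le_of_mem_relativePolydisc hz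
        rw [← ofReal_norm, norm_laurentMonomial α fun j => (hz' j).1]
        refine ENNReal.ofReal_le_ofReal (Real.exp_le_exp.2 ?_)
        rw [Finset.mul_sum, ← Finset.sum_sub_distrib]
        refine Finset.sum_le_sum fun j _ => ?_
        have h1 := mul_le_mul_of_nonneg_left (hz' j).2 (abs_nonneg (α j : ℝ))
        rw [← abs_mul] at h1
        have h2 := neg_abs_le ((α j : ℝ) * (logAbs z j - y j))
        nlinarith

theorem add_mem_of_mem_directionSpace {n : ℕ} {X : Set (Fin n → ℝ)} {v : Fin n → ℝ}
    (hv : v ∈ directionSpace X) {x : Fin n → ℝ} (hx : x ∈ X) : x + v ∈ X := by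
  have h : X + (directionSpace X : Set (Fin n → ℝ)) = X := (directionSpace_isGreatest X).1
  rw [← h]
  exact Set.add_mem_add hx hv

/-- If `logImage G` were invariant under a line, the translates of a small polydisc along a suitable
half of it would be disjoint subsets of `G` on which the integral of a monomial stays bounded
below. -/
theorem directionSpace_eq_bot_of_memLp {n : ℕ} {G : Set (Fin n → ℂ)} (hG : IsDomainCn G)
    (hc : IsNCircled G) {f : (Fin n → ℂ) → ℂ} (hf : DifferentiableOn ℂ f G) {p : ℝ≥0∞}
    (hp : 1 ≤ p) (hp' : p ≠ ∞) (hfp : MemLp f p (volume.restrict G))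
    (hne : ∃ z ∈ G, f z ≠ 0) : directionSpace (logImage G) = ⊥ := by
  have hX := isOpen_logImage hG.1
  have hP : 0 < p.toReal := ENNReal.toReal_pos (by positivity) hp'
  obtain ⟨a, ha⟩ := exists_hasLaurentCoeff hG hc hf
  obtain ⟨α, hα⟩ : ∃ α, a α ≠ 0 := by
    by_contra hall
    push Not at hall
    obtain ⟨z, hz, hfz⟩ := hne
    have hopen : IsOpen (G ∩ {w | f w ≠ 0}) :=
      hf.continuousOn.isOpen_inter_preimage hG.1 isOpen_ne
    obtain ⟨w, hw0, hw, hfw⟩ := (dense_forall_ne_zero n).exists_mem_open hopen ⟨z, hz, hfz⟩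
    exact hfw (by rw [← hc.laurent_tsum_eq hG.1 hf ha hw hw0]; simp [hall])
  have hfin := lintegral_laurentMonomial_lt_top hG.1 hc hf hp hp' hfp ha hα
  rw [Submodule.eq_bot_iff]
  by_contra hnot
  push Not at hnot
  obtain ⟨v, hv, hv0, hvs⟩ : ∃ v ∈ directionSpace (logImage G), v ≠ 0 ∧
      0 ≤ ∑ j, (p.toReal * α j + 2) * v j := by
    obtain ⟨v, hv, hv0⟩ := hnot
    rcases le_total 0 (∑ j, (p.toReal * α j + 2) * v j) with h | h
    · exact ⟨v, hv, hv0, h⟩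
    · refine ⟨-v, neg_mem hv, neg_ne_zero.2 hv0, ?_⟩
      simp only [Pi.neg_apply, mul_neg, Finset.sum_neg_distrib]
      linarith
  obtain ⟨j, hj⟩ := Function.ne_iff.1 hv0
  have hj : 0 < |v j| := abs_pos.2 hj
  obtain ⟨x, hx⟩ := nonempty_logImage hG hc
  obtain ⟨r, hr, hb⟩ := Metric.isOpen_iff.1 hX x hx
  obtain ⟨ε, hε, hεr⟩ : ∃ ε > 0, ε < r := ⟨r / 2, by positivity, by linarith⟩
  -- consecutive translates are more than `2 * ε` apart in the `j`-th logarithmic coordinate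
  let s := 3 * ε / |v j|
  let y : ℕ → Fin n → ℝ := fun m => x + (m * s : ℝ) • v
  have hsub : ∀ m, relativePolydisc ε (y m) ⊆ G ∩ {z | ∀ j, z j ≠ 0} := by
    intro m z hz
    have hz' := abs_log_sub_le_of_mem_relativePolydisc hz
    refine ⟨(hc.logAbs_mem_iff fun j => (hz' j).1).1 ?_, fun j => (hz' j).1⟩
    have h1 : logAbs z - (m * s : ℝ) • v ∈ logImage G := by
      refine hb ((dist_pi_lt_iff hr).2 fun i => ?_)
      rw [Real.dist_eq]
      refine lt_of_le_of_lt (le_of_eq_of_le ?_ (hz' i).2) hεr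
      simp only [y, Pi.sub_apply, Pi.add_apply]
      ring_nf
    have := add_mem_of_mem_directionSpace (Submodule.smul_mem _ (m * s : ℝ) hv) h1
    rwa [sub_add_cancel] at this
  have hdisj : Pairwise (Function.onFun Disjoint fun m => relativePolydisc ε (y m)) := by
    intro m m' hmm
    refine Set.disjoint_left.2 fun z hz hz' => ?_
    have h1 := (abs_log_sub_le_of_mem_relativePolydisc hz j).2
    have h2 := (abs_log_sub_le_of_mem_relativePolydisc hz' j).2
    have h3 : |y m j - y m' j| ≤ 2 * ε := by
      have := abs_sub_le (y m j) (logAbs z j) (y m' j)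
      rw [abs_sub_comm (y m j) (logAbs z j)] at this
      linarith
    have h4 : |y m j - y m' j| = |(m : ℝ) - m'| * (3 * ε) := by
      have : y m j - y m' j = ((m : ℝ) - m') * s * v j := by
        simp only [y, Pi.add_apply, Pi.smul_apply, smul_eq_mul]; ring
      rw [this, abs_mul, abs_mul, abs_of_pos (by positivity : 0 < s), mul_assoc]
      congr 1
      exact div_mul_cancel₀ _ hj.ne'
    have h5 : (1 : ℝ) ≤ |(m : ℝ) - m'| := by
      have : (1 : ℤ) ≤ |(m : ℤ) - m'| := Int.one_le_abs (sub_ne_zero.2 (by exact_mod_cast hmm))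
      exact_mod_cast this
    nlinarith
  have hδ : 0 < 1 - Real.exp (-ε) := by
    have := Real.exp_lt_exp.2 (neg_lt_zero.2 hε)
    rw [Real.exp_zero] at this; linarith
  have hlow : ∀ m, ENNReal.ofReal (Real.exp (∑ j, (p.toReal * α j + 2) * x j)
      * (Real.exp (-(p.toReal * (ε * ∑ j, |(α j : ℝ)|)))
        * ((1 - Real.exp (-ε)) ^ 2 * Real.pi) ^ n))
      ≤ ∫⁻ z in relativePolydisc ε (y m), ‖laurentMonomial α z‖ₑ ^ p.toReal := by
    intro m
    refine le_trans (ENNReal.ofReal_le_ofReal ?_) (lintegral_relativePolydisc_ge hε hP α (y m))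
    refine mul_le_mul_of_nonneg_right (Real.exp_le_exp.2 ?_) (by positivity)
    have : ∑ j, (p.toReal * α j + 2) * y m j = ∑ j, (p.toReal * α j + 2) * x j
        + (m * s) * ∑ j, (p.toReal * α j + 2) * v j := by
      rw [Finset.mul_sum, ← Finset.sum_add_distrib]
      refine Finset.sum_congr rfl fun j _ => ?_
      simp only [y, Pi.add_apply, Pi.smul_apply, smul_eq_mul]; ring
    rw [this]
    have : 0 ≤ (m * s) * ∑ j, (p.toReal * α j + 2) * v j := by positivity
    linarith
  have hmeas : ∀ m, MeasurableSet (relativePolydisc ε (y m)) :=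
    fun m => MeasurableSet.univ_pi fun j => measurableSet_ball
  have htop := ENNReal.tsum_le_tsum hlow
  rw [ENNReal.tsum_const_eq_top_of_ne_zero (ENNReal.ofReal_pos.2 (by positivity)).ne',
    ← lintegral_iUnion hmeas hdisj] at htop
  exact absurd (htop.trans (lintegral_mono_set (iUnion_subset hsub))) (not_le.2 hfin)

/-! ### Linear functionals tending to `-∞` on a convex set -/

/-- The linear functional `ξ` is bounded above on `X`, with a margin `d` in the sense that
`⟨ξ, x⟩ ≤ M - d * ∑ |x j|` on `X`. -/
def HasMargin {n : ℕ} (X : Set (Fin n → ℝ)) (d : ℝ) (ξ : Fin n → ℝ) : Prop :=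
  ∃ M, ∀ x ∈ X, ∑ j, ξ j * x j + d * ∑ j, |x j| ≤ M

section HasMargin

variable {n : ℕ} {X : Set (Fin n → ℝ)} {d e : ℝ} {ξ η : Fin n → ℝ}

theorem HasMargin.add (hξ : HasMargin X d ξ) (hη : HasMargin X e η) :
    HasMargin X (d + e) (ξ + η) := by
  obtain ⟨M, hM⟩ := hξ
  obtain ⟨N, hN⟩ := hη
  refine ⟨M + N, fun x hx => ?_⟩
  have := add_le_add (hM x hx) (hN x hx)
  simp only [Pi.add_apply, add_mul, Finset.sum_add_distrib]
  linarith

theorem HasMargin.smul (hξ : HasMargin X d ξ) {c : ℝ} (hc : 0 ≤ c) :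
    HasMargin X (c * d) (c • ξ) := by
  obtain ⟨M, hM⟩ := hξ
  refine ⟨c * M, fun x hx => ?_⟩
  have := mul_le_mul_of_nonneg_left (hM x hx) hc
  simp only [Pi.smul_apply, smul_eq_mul, mul_assoc, ← Finset.mul_sum]
  linarith

theorem HasMargin.perturb (hξ : HasMargin X d ξ) {c : ℝ} (hη : ∀ j, |η j - ξ j| ≤ c)
    (he : e + c ≤ d) : HasMargin X e η := by
  obtain ⟨M, hM⟩ := hξ
  refine ⟨M, fun x hx => le_trans ?_ (hM x hx)⟩
  have h1 : ∑ j, η j * x j ≤ ∑ j, (ξ j * x j + c * |x j|) := Finset.sum_le_sum fun j _ => by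
    have h2 := mul_le_mul_of_nonneg_right (hη j) (abs_nonneg (x j))
    rw [← abs_mul] at h2
    have h3 := le_abs_self ((η j - ξ j) * x j)
    linarith
  rw [Finset.sum_add_distrib, ← Finset.mul_sum] at h1
  have h4 : 0 ≤ ∑ j, |x j| := Finset.sum_nonneg fun _ _ => abs_nonneg _
  nlinarith

/-- If no functional had a positive margin, the functionals bounded above on `X` would be
annihilated by a common vector, along which `X` would be invariant by the Hahn–Banach theorem. -/
theorem exists_hasMargin_one (hX : IsOpen X) (hc : Convex ℝ X) (hne : X.Nonempty)
    (hdir : directionSpace X = ⊥) : ∃ ξ, HasMargin X 1 ξ := by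
  let W : Submodule ℝ (Fin n → ℝ) :=
    { carrier := {ξ | ∃ b, HasMargin X 0 (b + ξ) ∧ HasMargin X 0 (b - ξ)}
      zero_mem' := ⟨0, by simp only [add_zero]; exact ⟨0, by simp⟩,
        by simp only [sub_zero]; exact ⟨0, by simp⟩⟩
      add_mem' := by
        rintro ξ η ⟨b, h1, h2⟩ ⟨b', h3, h4⟩
        refine ⟨b + b', ?_, ?_⟩
        · have := h1.add h3; rw [zero_add] at this; convert this using 1; abel
        · have := h2.add h4; rw [zero_add] at this; convert this using 1; abel
      smul_mem' := by
        rintro c ξ ⟨b, h1, h2⟩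
        refine ⟨|c| • b, ?_⟩
        have h1' := h1.smul (abs_nonneg c)
        have h2' := h2.smul (abs_nonneg c)
        rw [mul_zero] at h1' h2'
        rcases abs_cases c with ⟨hc, -⟩ | ⟨hc, -⟩
        · rw [hc] at h1' h2' ⊢
          exact ⟨by rwa [← smul_add], by rwa [← smul_sub]⟩
        · rw [hc] at h1' h2' ⊢
          refine ⟨?_, ?_⟩
          · convert h2' using 1; module
          · convert h1' using 1; module }
  have hW : ∀ ξ, HasMargin X 0 ξ → ξ ∈ W := fun ξ hξ => by
    refine ⟨ξ, ?_, ?_⟩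
    · have := hξ.add hξ; rwa [zero_add] at this
    · rw [sub_self]; exact ⟨0, by simp⟩
  have htop : W = ⊤ := by
    by_contra hlt
    obtain ⟨f, hf0, hf⟩ := W.exists_le_ker_of_lt_top (lt_top_iff_ne_top.2 hlt)
    let v : Fin n → ℝ := fun i => f fun j => if i = j then 1 else 0
    have hfv : ∀ ξ, f ξ = ∑ i, ξ i * v i := fun ξ => by
      rw [LinearMap.pi_apply_eq_sum_univ f ξ]; rfl
    have hcl : ∀ x ∈ X, ∀ t : ℝ, x + t • v ∈ closure X := by
      intro x hx t
      by_contra hnot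
      obtain ⟨g, u, hg, hgu⟩ := geometric_hahn_banach_closed_point hc.closure isClosed_closure hnot
      let ξ : Fin n → ℝ := fun i => g fun j => if i = j then 1 else 0
      have hgξ : ∀ y, g y = ∑ i, ξ i * y i := fun y => by
        have := LinearMap.pi_apply_eq_sum_univ (g : (Fin n → ℝ) →ₗ[ℝ] ℝ) y
        rw [ContinuousLinearMap.coe_coe] at this
        rw [this]
        exact Finset.sum_congr rfl fun i _ => mul_comm _ _
      have hm : HasMargin X 0 ξ := ⟨u, fun y hy => by
        rw [zero_mul, add_zero, ← hgξ]; exact (hg y (subset_closure hy)).le⟩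
      have h0 : g v = 0 := by
        have := hf (hW ξ hm)
        rw [LinearMap.mem_ker, hfv] at this
        rw [hgξ, this]
      rw [map_add, map_smul, h0, smul_zero, add_zero] at hgu
      exact lt_asymm hgu (hg x (subset_closure hx))
    have hmem : ∀ x ∈ X, ∀ t : ℝ, x + t • v ∈ X := by
      intro x hx t
      have : x + t • v ∈ interior (closure X) := by
        refine mem_interior.2 ⟨(fun y => y - t • v) ⁻¹' X, fun y hy => ?_,
          hX.preimage (by fun_prop), by simpa using hx⟩
        have := hcl _ hy t
        rwa [sub_add_cancel] at this
      rwa [hc.interior_closure_eq_interior_of_nonempty_interior (by rwa [hX.interior_eq]),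
        hX.interior_eq] at this
    have hspan : Submodule.span ℝ {v} ≤ directionSpace X := by
      refine (directionSpace_isGreatest X).2 (Subset.antisymm ?_ fun x hx => ?_)
      · rintro _ ⟨x, hx, w, hw, rfl⟩
        obtain ⟨t, rfl⟩ := Submodule.mem_span_singleton.1 hw
        exact hmem x hx t
      · exact ⟨x, hx, 0, Submodule.zero_mem _, by simp⟩
    rw [hdir, le_bot_iff, Submodule.span_singleton_eq_bot] at hspan
    exact hf0 (LinearMap.ext fun ξ => by rw [hfv, hspan]; simp)
  have hb : ∀ j, ∃ b : Fin n → ℝ, ∃ M, ∀ x ∈ X, ∑ i, b i * x i + |x j| ≤ M := by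
    intro j
    obtain ⟨b, ⟨M, hM⟩, N, hN⟩ : Pi.single j 1 ∈ W := htop ▸ Submodule.mem_top
    refine ⟨b, max M N, fun x hx => ?_⟩
    have h1 := hM x hx
    have h2 := hN x hx
    simp only [Pi.add_apply, Pi.sub_apply, add_mul, sub_mul, Finset.sum_add_distrib,
      Finset.sum_sub_distrib, zero_mul, add_zero, Pi.single_apply, ite_mul, one_mul,
      Finset.sum_ite_eq', Finset.mem_univ, if_true] at h1 h2
    rcases abs_cases (x j) with ⟨h, -⟩ | ⟨h, -⟩
    · rw [h]; exact h1.trans (le_max_left _ _)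
    · rw [h, ← sub_eq_add_neg]; exact h2.trans (le_max_right _ _)
  choose b M hM using hb
  refine ⟨fun i => ∑ j, b j i, ∑ j, M j, fun x hx => ?_⟩
  rw [one_mul]
  simp only [Finset.sum_mul]
  rw [Finset.sum_comm, ← Finset.sum_add_distrib]
  exact Finset.sum_le_sum fun j _ => hM j x hx

theorem exists_int_hasMargin (hX : IsOpen X) (hc : Convex ℝ X) (hne : X.Nonempty)
    (hdir : directionSpace X = ⊥) (hd : 0 ≤ d) :
    ∃ β : Fin n → ℤ, HasMargin X d fun j => (β j : ℝ) := by
  obtain ⟨ξ, hξ⟩ := exists_hasMargin_one hX hc hne hdir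
  refine ⟨fun j => round ((d + 1) * ξ j), (hξ.smul (c := d + 1) (by linarith)).perturb
    (c := 1 / 2) (fun j => ?_) (by linarith)⟩
  rw [abs_sub_comm]
  exact abs_sub_round _

/-- Points outside the closure of `X` are separated from `X` by integral functionals of prescribed
margin: a large multiple of a separating functional is rounded off after adding a functional of
large margin. -/
theorem exists_int_separating (hX : IsOpen X) (hc : Convex ℝ X) (hne : X.Nonempty)
    (hdir : directionSpace X = ⊥) (hd : 0 ≤ d) {x₀ : Fin n → ℝ} (hx₀ : x₀ ∉ closure X) :
    ∃ (α : Fin n → ℤ) (S : ℝ), HasMargin X d (fun j => (α j : ℝ)) ∧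
      (∀ x ∈ X, ∑ j, α j * x j ≤ S) ∧ S < ∑ j, α j * x₀ j := by
  obtain ⟨g, u, hg, hgu⟩ := geometric_hahn_banach_closed_point hc.closure isClosed_closure hx₀
  let ξ : Fin n → ℝ := fun i => g fun j => if i = j then 1 else 0
  have hgξ : ∀ y, g y = ∑ i, ξ i * y i := fun y => by
    have := LinearMap.pi_apply_eq_sum_univ (g : (Fin n → ℝ) →ₗ[ℝ] ℝ) y
    rw [ContinuousLinearMap.coe_coe] at this
    rw [this]
    exact Finset.sum_congr rfl fun i _ => mul_comm _ _
  obtain ⟨β, M, hM⟩ := exists_int_hasMargin hX hc hne hdir (d := d + 1) (by linarith)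
  obtain ⟨N, hN⟩ := exists_nat_gt
    ((M + 1 / 2 * ∑ j, |x₀ j| - ∑ j, β j * x₀ j) / (g x₀ - u))
  rw [div_lt_iff₀ (by linarith)] at hN
  have hround : ∀ x : Fin n → ℝ, |∑ j, (round (N * ξ j) + β j : ℤ) * x j
      - (N * g x + ∑ j, β j * x j)| ≤ 1 / 2 * ∑ j, |x j| := by
    intro x
    rw [hgξ, Finset.mul_sum, ← Finset.sum_add_distrib, ← Finset.sum_sub_distrib, Finset.mul_sum]
    refine (Finset.abs_sum_le_sum_abs _ _).trans (Finset.sum_le_sum fun j _ => ?_)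
    have : ((round (N * ξ j) + β j : ℤ) : ℝ) * x j - (N * (ξ j * x j) + β j * x j)
        = (round (N * ξ j) - N * ξ j) * x j := by push_cast; ring
    rw [this, abs_mul, abs_sub_comm]
    exact mul_le_mul_of_nonneg_right (abs_sub_round _) (abs_nonneg _)
  have hbound : ∀ x ∈ X, ∑ j, (round (N * ξ j) + β j : ℤ) * x j + d * ∑ j, |x j| ≤ N * u + M := by
    intro x hx
    have h1 := (abs_le.1 (hround x)).2
    have h2 := hM x hx
    have h3 := mul_le_mul_of_nonneg_left (hg x (subset_closure hx)).le (Nat.cast_nonneg (α := ℝ) N)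
    have h4 : 0 ≤ ∑ j, |x j| := Finset.sum_nonneg fun _ _ => abs_nonneg _
    linarith
  refine ⟨fun j => round (N * ξ j) + β j, N * u + M, ⟨_, hbound⟩, fun x hx => ?_, ?_⟩
  · have h4 : 0 ≤ d * ∑ j, |x j| := mul_nonneg hd (Finset.sum_nonneg fun _ _ => abs_nonneg _)
    linarith [hbound x hx]
  · have h1 := (abs_le.1 (hround x₀)).1
    linarith

end HasMargin

/-! ### Quotients of monomials -/

/-- The function `∏ min(|z j|, 1 / |z j|) ^ 3`, which vanishes on the coordinate hyperplanes. -/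
noncomputable def decayWeight {n : ℕ} (z : Fin n → ℂ) : ℝ := ∏ j, min ‖z j‖ ‖z j‖⁻¹ ^ 3

theorem min_inv_nonneg {r : ℝ} (hr : 0 ≤ r) : 0 ≤ min r r⁻¹ := le_min hr (inv_nonneg.2 hr)

theorem min_inv_le_one (r : ℝ) : min r r⁻¹ ≤ 1 := by
  rcases le_total r 1 with h | h
  · exact (min_le_left _ _).trans h
  · exact (min_le_right _ _).trans (inv_le_one_of_one_le₀ h)

theorem decayWeight_nonneg {n : ℕ} (z : Fin n → ℂ) : 0 ≤ decayWeight z :=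
  Finset.prod_nonneg fun _ _ => pow_nonneg (min_inv_nonneg (norm_nonneg _)) _

theorem decayWeight_le_norm {n : ℕ} (z : Fin n → ℂ) (j : Fin n) : decayWeight z ≤ ‖z j‖ := by
  have h0 := fun i => min_inv_nonneg (norm_nonneg (z i))
  have h1 := fun i => min_inv_le_one ‖z i‖
  rw [decayWeight, ← Finset.mul_prod_erase _ _ (Finset.mem_univ j)]
  calc _ ≤ min ‖z j‖ ‖z j‖⁻¹ ^ 3 * 1 :=
        mul_le_mul_of_nonneg_left (Finset.prod_le_one (fun i _ => pow_nonneg (h0 i) _)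
          fun i _ => pow_le_one₀ (h0 i) (h1 i)) (pow_nonneg (h0 j) _)
    _ ≤ min ‖z j‖ ‖z j‖⁻¹ := by
        rw [mul_one]; exact pow_le_of_le_one (h0 j) (h1 j) (by norm_num)
    _ ≤ ‖z j‖ := min_le_left _ _

theorem decayWeight_le_one {n : ℕ} (z : Fin n → ℂ) : decayWeight z ≤ 1 :=
  Finset.prod_le_one (fun _ _ => pow_nonneg (min_inv_nonneg (norm_nonneg _)) _)
    fun _ _ => pow_le_one₀ (min_inv_nonneg (norm_nonneg _)) (min_inv_le_one _)

theorem decayWeight_le_prod {n : ℕ} (z : Fin n → ℂ) :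
    decayWeight z ≤ ∏ j, (8 * (1 + ‖z j‖) ^ (-3 : ℝ)) := by
  refine Finset.prod_le_prod (fun _ _ => pow_nonneg (min_inv_nonneg (norm_nonneg _)) _)
    fun j _ => ?_
  have hr := norm_nonneg (z j)
  have h2 : min ‖z j‖ ‖z j‖⁻¹ ≤ 2 / (1 + ‖z j‖) := by
    rw [le_div_iff₀ (by positivity)]
    rcases hr.eq_or_lt with h | h
    · rw [← h]; norm_num
    rcases le_total ‖z j‖ 1 with h1 | h1
    · have := min_le_left ‖z j‖ ‖z j‖⁻¹
      nlinarith
    · have := min_le_right ‖z j‖ ‖z j‖⁻¹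
      have e : ‖z j‖⁻¹ * ‖z j‖ = 1 := inv_mul_cancel₀ h.ne'
      have e1 := inv_le_one_of_one_le₀ h1
      nlinarith
  calc _ ≤ (2 / (1 + ‖z j‖)) ^ 3 := pow_le_pow_left₀ (min_inv_nonneg hr) h2 3
    _ = _ := by
      rw [Real.rpow_neg (by positivity), div_pow, div_eq_mul_inv]
      norm_num

theorem integrable_decay_prod (n : ℕ) :
    Integrable fun z : Fin n → ℂ => ∏ j, (8 * (1 + ‖z j‖) ^ (-3 : ℝ)) := by
  refine Integrable.fintype_prod (f := fun _ (w : ℂ) => 8 * (1 + ‖w‖) ^ (-3 : ℝ)) fun _ => ?_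
  refine (integrable_one_add_norm ?_).const_mul _
  rw [Complex.finrank_real_complex]; norm_num

theorem memLp_of_norm_le_decayWeight {n : ℕ} {G : Set (Fin n → ℂ)} (hG : IsOpen G)
    {f : (Fin n → ℂ) → ℂ} (hf : ContinuousOn f G) {C : ℝ}
    (hC : ∀ z ∈ G, ‖f z‖ ≤ C * decayWeight z) {p : ℝ≥0∞} (hp : 1 ≤ p) :
    MemLp f p (volume.restrict G) := by
  have hmeas : AEStronglyMeasurable f (volume.restrict G) :=
    hf.aestronglyMeasurable hG.measurableSet
  have hC' : ∀ z ∈ G, ‖f z‖ ≤ |C| * decayWeight z := fun z hz => (hC z hz).trans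
    (mul_le_mul_of_nonneg_right (le_abs_self C) (decayWeight_nonneg z))
  have hae := ae_restrict_mem (μ := (volume : Measure (Fin n → ℂ))) hG.measurableSet
  rcases eq_or_ne p ∞ with rfl | hp'
  · refine memLp_top_of_bound hmeas |C| ?_
    filter_upwards [hae] with z hz
    exact (hC' z hz).trans (mul_le_of_le_one_right (abs_nonneg C) (decayWeight_le_one z))
  · have hp1 : 1 ≤ p.toReal := by
      rw [← ENNReal.toReal_one]; exact ENNReal.toReal_mono hp' hp
    rw [← integrable_norm_rpow_iff hmeas (by positivity) hp']
    refine Integrable.mono' (((integrable_decay_prod n).const_mul (|C| ^ p.toReal)).restrict)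
      (hmeas.norm.aemeasurable.pow_const _).aestronglyMeasurable ?_
    filter_upwards [hae] with z hz
    rw [Real.norm_of_nonneg (by positivity)]
    calc ‖f z‖ ^ p.toReal ≤ (|C| * decayWeight z) ^ p.toReal :=
          Real.rpow_le_rpow (norm_nonneg _) (hC' z hz) (by linarith)
      _ = |C| ^ p.toReal * decayWeight z ^ p.toReal :=
          Real.mul_rpow (abs_nonneg _) (decayWeight_nonneg z)
      _ ≤ |C| ^ p.toReal * decayWeight z := by
          refine mul_le_mul_of_nonneg_left ?_ (by positivity)
          rcases (decayWeight_nonneg z).eq_or_lt with h | h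
          · rw [← h, Real.zero_rpow (by linarith)]
          · exact (Real.rpow_le_rpow_of_exponent_ge h (decayWeight_le_one z) hp1).trans_eq
              (Real.rpow_one _)
      _ ≤ _ := mul_le_mul_of_nonneg_left (decayWeight_le_prod z) (by positivity)

section Quotients

variable {n : ℕ} {G : Set (Fin n → ℂ)}

/-- Where `G` meets the hyperplane `z j = 0`, a monomial of positive margin contains a positive
power of `z j`. -/
theorem HasMargin.pos_of_apply_eq_zero (hG : IsOpen G) (hc : IsNCircled G) {d : ℝ} (hd : 0 < d)
    {γ : Fin n → ℤ} (hγ : HasMargin (logImage G) d fun j => (γ j : ℝ)) {z : Fin n → ℂ}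
    (hz : z ∈ G) {j : Fin n} (hj : z j = 0) : 0 < γ j := by
  by_contra hneg
  have hneg' : (γ j : ℝ) ≤ 0 := by exact_mod_cast not_lt.1 hneg
  obtain ⟨M, hM⟩ := hγ
  obtain ⟨ε, hε, hb⟩ := exists_box_subset_logImage hG hc hz
  let y : Fin n → ℝ := fun i => Real.log (‖z i‖ + ε / 2)
  have hyj : y j = Real.log (ε / 2) := by simp only [y, hj, norm_zero, zero_add]
  have key : ∀ s ≤ y j, ∑ i, γ i * y i - d * s ≤ M := by
    intro s hs
    have hmem : Function.update y j s ∈ logImage G := hb fun i => by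
      rcases eq_or_ne i j with rfl | hi
      · rw [Function.update_self, hj, norm_zero, sub_zero, abs_of_pos (Real.exp_pos s)]
        rw [hyj] at hs
        have := (Real.le_log_iff_exp_le (half_pos hε)).1 hs
        linarith
      · rw [Function.update_of_ne hi, Real.exp_log (by positivity), add_sub_cancel_left,
          abs_of_pos (half_pos hε)]
        linarith
    have h1 := hM _ hmem
    rw [sum_mul_update (fun i => (γ i : ℝ))] at h1
    have h2 : -s ≤ ∑ i, |Function.update y j s i| := by
      have := Finset.single_le_sum (f := fun i => |Function.update y j s i|)
        (fun _ _ => abs_nonneg _) (Finset.mem_univ j)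
      rw [Function.update_self] at this
      exact (neg_le_abs s).trans this
    have h3 := mul_le_mul_of_nonneg_left h2 hd.le
    nlinarith
  have h1 := key (min (y j) ((∑ i, γ i * y i - M - 1) / d)) (min_le_left _ _)
  have h2 := mul_le_mul_of_nonneg_left
    (min_le_right (y j) ((∑ i, γ i * y i - M - 1) / d)) hd.le
  rw [mul_div_cancel₀ _ hd.ne'] at h2
  linarith

theorem HasMargin.laurentMonomial_eq_zero (hG : IsOpen G) (hc : IsNCircled G) {d : ℝ} (hd : 0 < d)
    {γ : Fin n → ℤ} (hγ : HasMargin (logImage G) d fun j => (γ j : ℝ)) {z : Fin n → ℂ}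
    (hz : z ∈ G) {j : Fin n} (hj : z j = 0) : laurentMonomial γ z = 0 :=
  _root_.laurentMonomial_eq_zero hj (hγ.pos_of_apply_eq_zero hG hc hd hz hj).ne'

theorem HasMargin.ne_zero_or_nonneg (hG : IsOpen G) (hc : IsNCircled G) {d : ℝ} (hd : 0 < d)
    {γ : Fin n → ℤ} (hγ : HasMargin (logImage G) d fun j => (γ j : ℝ)) {z : Fin n → ℂ}
    (hz : z ∈ G) (j : Fin n) : z j ≠ 0 ∨ 0 ≤ γ j := by
  by_cases hj : z j = 0
  · exact Or.inr (hγ.pos_of_apply_eq_zero hG hc hd hz hj).le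
  · exact Or.inl hj

theorem HasMargin.norm_laurentMonomial_le (hG : IsOpen G) (hc : IsNCircled G) {d : ℝ} (hd : 3 ≤ d)
    {γ : Fin n → ℤ} (hγ : HasMargin (logImage G) d fun j => (γ j : ℝ)) :
    ∃ C, 0 ≤ C ∧ ∀ z ∈ G, ‖laurentMonomial γ z‖ ≤ C * decayWeight z := by
  obtain ⟨M, hM⟩ := id hγ
  refine ⟨Real.exp M, (Real.exp_pos M).le, fun z hz => ?_⟩
  by_cases h0 : ∀ j, z j ≠ 0
  · have hw : decayWeight z = Real.exp (-(3 * ∑ j, |logAbs z j|)) := by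
      rw [decayWeight, Finset.mul_sum, ← Finset.sum_neg_distrib, Real.exp_sum]
      refine Finset.prod_congr rfl fun j _ => ?_
      have hpos := norm_pos_iff.2 (h0 j)
      have : min ‖z j‖ ‖z j‖⁻¹ = Real.exp (-|logAbs z j|) := by
        rw [logAbs]
        rcases le_total ‖z j‖ 1 with h | h
        · rw [abs_of_nonpos (Real.log_nonpos hpos.le h), neg_neg, Real.exp_log hpos,
            min_eq_left (h.trans ((one_le_inv₀ hpos).2 h))]
        · rw [abs_of_nonneg (Real.log_nonneg h), Real.exp_neg, Real.exp_log hpos,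
            min_eq_right ((inv_le_one_of_one_le₀ h).trans h)]
      rw [this, ← Real.exp_nat_mul]
      push_cast
      ring_nf
    rw [norm_laurentMonomial γ h0, hw, ← Real.exp_add]
    refine Real.exp_le_exp.2 ?_
    have h1 := hM _ ((hc.logAbs_mem_iff h0).2 hz)
    have h2 : 0 ≤ ∑ j, |logAbs z j| := Finset.sum_nonneg fun _ _ => abs_nonneg _
    nlinarith
  · push Not at h0
    obtain ⟨j, hj⟩ := h0
    rw [hγ.laurentMonomial_eq_zero hG hc (by linarith) hz hj, norm_zero]
    exact mul_nonneg (Real.exp_pos M).le (decayWeight_nonneg z)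

/-- Linear combinations of quotients `z ^ γ / (z ^ α - c) ^ m` in which every `γ` has margin `d`
on `logImage G`. -/
inductive QuotientSum (G : Set (Fin n → ℂ)) (α : Fin n → ℤ) (c : ℂ) (d : ℝ) :
    ((Fin n → ℂ) → ℂ) → Prop
  | term (b : ℂ) (γ : Fin n → ℤ) (m : ℕ) (hγ : HasMargin (logImage G) d fun j => (γ j : ℝ)) :
    QuotientSum G α c d
      fun z => b * (laurentMonomial γ z * (laurentMonomial α z - c) ^ (-(m : ℤ)))
  | add {f g : (Fin n → ℂ) → ℂ} (hf : QuotientSum G α c d f) (hg : QuotientSum G α c d g) :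
    QuotientSum G α c d fun z => f z + g z

variable {α : Fin n → ℤ} {c : ℂ} {d δ : ℝ} {f : (Fin n → ℂ) → ℂ}

theorem QuotientSum.differentiableOn (hG : IsOpen G) (hc : IsNCircled G)
    (hα : HasMargin (logImage G) 1 fun j => (α j : ℝ)) (hδ : 0 < δ)
    (hαc : ∀ z ∈ G, δ ≤ ‖laurentMonomial α z - c‖) (hd : 0 < d) (hf : QuotientSum G α c d f) :
    DifferentiableOn ℂ f G := by
  induction hf with
  | term b γ m hγ =>
    intro z hz
    have h1 := differentiableAt_laurentMonomial (hγ.ne_zero_or_nonneg hG hc hd hz)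
    have h2 := differentiableAt_laurentMonomial (hα.ne_zero_or_nonneg hG hc one_pos hz)
    have h3 : laurentMonomial α z - c ≠ 0 := norm_pos_iff.1 (hδ.trans_le (hαc z hz))
    have h4 : DifferentiableAt ℂ (fun z => (laurentMonomial α z - c) ^ (-(m : ℤ))) z :=
      (h2.sub_const c).zpow (Or.inl h3)
    exact ((h1.mul h4).const_mul b).differentiableWithinAt
  | add _ _ h1 h2 => exact h1.add h2

theorem QuotientSum.norm_le (hG : IsOpen G) (hc : IsNCircled G) (hδ : 0 < δ)
    (hαc : ∀ z ∈ G, δ ≤ ‖laurentMonomial α z - c‖) (hd : 3 ≤ d) (hf : QuotientSum G α c d f) :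
    ∃ C, ∀ z ∈ G, ‖f z‖ ≤ C * decayWeight z := by
  induction hf with
  | term b γ m hγ =>
    obtain ⟨C, hC0, hC⟩ := hγ.norm_laurentMonomial_le hG hc hd
    refine ⟨‖b‖ * (C * (δ ^ m)⁻¹), fun z hz => ?_⟩
    have h1 : ‖(laurentMonomial α z - c) ^ (-(m : ℤ))‖ ≤ (δ ^ m)⁻¹ := by
      rw [zpow_neg, zpow_natCast, norm_inv, norm_pow]
      exact inv_anti₀ (by positivity) (pow_le_pow_left₀ hδ.le (hαc z hz) m)
    rw [norm_mul, norm_mul]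
    calc _ ≤ ‖b‖ * ((C * decayWeight z) * (δ ^ m)⁻¹) :=
          mul_le_mul_of_nonneg_left (mul_le_mul (hC z hz) h1 (norm_nonneg _)
            (mul_nonneg hC0 (decayWeight_nonneg z))) (norm_nonneg _)
      _ = _ := by ring
  | add _ _ h1 h2 =>
    obtain ⟨C, hC⟩ := h1
    obtain ⟨D, hD⟩ := h2
    exact ⟨C + D, fun z hz => (norm_add_le _ _).trans (by linarith [hC z hz, hD z hz])⟩

theorem QuotientSum.continuousAt (hδ : 0 < δ)
    (hαc : ∀ z ∈ G, δ ≤ ‖laurentMonomial α z - c‖) (hf : QuotientSum G α c d f)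
    {z : Fin n → ℂ} (hz : z ∈ closure G) (h0 : ∀ j, z j ≠ 0) : ContinuousAt f z := by
  induction hf with
  | term b γ m hγ =>
    have h1 := (differentiableAt_laurentMonomial (γ := γ) fun j => Or.inl (h0 j)).continuousAt
    have h2 := (differentiableAt_laurentMonomial (γ := α) fun j => Or.inl (h0 j)).continuousAt
    have := mem_closure_iff_nhdsWithin_neBot.1 hz
    have h3 : δ ≤ ‖laurentMonomial α z - c‖ := by
      have ht : Filter.Tendsto (fun w => ‖laurentMonomial α w - c‖) (nhdsWithin z G)
          (nhds ‖laurentMonomial α z - c‖) :=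
        ((h2.sub continuousAt_const).norm).tendsto.mono_left nhdsWithin_le_nhds
      exact ge_of_tendsto ht (eventually_mem_nhdsWithin.mono hαc)
    exact continuousAt_const.mul (h1.mul ((h2.sub continuousAt_const).zpow₀ _
      (Or.inl (norm_pos_iff.1 (hδ.trans_le h3)))))
  | add _ _ h1 h2 => exact h1.add h2

theorem QuotientSum.exists_tendsto (hG : IsOpen G) (hc : IsNCircled G) (hδ : 0 < δ)
    (hαc : ∀ z ∈ G, δ ≤ ‖laurentMonomial α z - c‖) (hd : 3 ≤ d) (hf : QuotientSum G α c d f)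
    {z : Fin n → ℂ} (hz : z ∈ closure G) :
    ∃ y, Filter.Tendsto f (nhdsWithin z G) (nhds y) := by
  by_cases h0 : ∀ j, z j ≠ 0
  · exact ⟨_, (hf.continuousAt hδ hαc hz h0).tendsto.mono_left nhdsWithin_le_nhds⟩
  · push Not at h0
    obtain ⟨j, hj⟩ := h0
    obtain ⟨C, hC⟩ := hf.norm_le hG hc hδ hαc hd
    refine ⟨0, squeeze_zero_norm' (a := fun w => |C| * ‖w j‖) ?_ ?_⟩
    · filter_upwards [self_mem_nhdsWithin] with w hw
      calc ‖f w‖ ≤ C * decayWeight w := hC w hw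
        _ ≤ |C| * decayWeight w :=
          mul_le_mul_of_nonneg_right (le_abs_self C) (decayWeight_nonneg w)
        _ ≤ _ := mul_le_mul_of_nonneg_left (decayWeight_le_norm w j) (abs_nonneg C)
    · have : ContinuousAt (fun w : Fin n → ℂ => |C| * ‖w j‖) z :=
        (continuous_const.mul (continuous_apply j).norm).continuousAt
      have := this.tendsto
      simp only [hj, norm_zero, mul_zero] at this
      exact this.mono_left nhdsWithin_le_nhds

theorem hasDerivAt_laurentMonomial_line {γ : Fin n → ℤ} {z : Fin n → ℂ} {j : Fin n}
    (h : z j ≠ 0 ∨ 0 ≤ γ j) :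
    HasDerivAt (fun t : ℂ => laurentMonomial γ (z + t • Pi.single j 1))
      (γ j * laurentMonomial (γ - Pi.single j 1) z) 0 := by
  have hprod : ∀ (η : Fin n → ℤ) (t : ℂ), laurentMonomial η (z + t • Pi.single j 1)
      = (z j + t) ^ η j * ∏ i ∈ Finset.univ.erase j, z i ^ η i := by
    intro η t
    rw [laurentMonomial, ← Finset.mul_prod_erase _ _ (Finset.mem_univ j)]
    congr 1
    · simp
    · refine Finset.prod_congr rfl fun i hi => ?_
      simp [(Finset.mem_erase.1 hi).1]
  have e : laurentMonomial (γ - Pi.single j 1) z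
      = z j ^ (γ j - 1) * ∏ i ∈ Finset.univ.erase j, z i ^ γ i := by
    have := hprod (γ - Pi.single j 1) 0
    rw [zero_smul, add_zero, add_zero] at this
    rw [this]
    congr 1
    · simp
    · refine Finset.prod_congr rfl fun i hi => ?_
      simp [(Finset.mem_erase.1 hi).1]
  have h1 : HasDerivAt (fun t : ℂ => (z j + t) ^ γ j) (γ j * z j ^ (γ j - 1)) 0 := by
    have h2 := hasDerivAt_zpow (𝕜 := ℂ) (γ j) (z j + 0) (by rwa [add_zero])
    have := HasDerivAt.comp_const_add (z j) 0 h2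
    rwa [add_zero] at this
  simp only [hprod]
  rw [e, ← mul_assoc]
  exact h1.mul_const _

theorem HasMargin.laurentMonomial_add (hG : IsOpen G) (hc : IsNCircled G) {e : ℝ} (hd : 0 < d)
    (he : 0 < e) {γ η : Fin n → ℤ} (hγ : HasMargin (logImage G) d fun j => (γ j : ℝ))
    (hγη : HasMargin (logImage G) e fun j => ((γ + η) j : ℝ)) {z : Fin n → ℂ} (hz : z ∈ G) :
    laurentMonomial (γ + η) z = laurentMonomial γ z * laurentMonomial η z := by
  by_cases h0 : ∀ j, z j ≠ 0
  · exact _root_.laurentMonomial_add γ η h0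
  · push Not at h0
    obtain ⟨j, hj⟩ := h0
    rw [hγ.laurentMonomial_eq_zero hG hc hd hz hj, hγη.laurentMonomial_eq_zero hG hc he hz hj,
      zero_mul]

/-- A partial derivative lowers the margin of the exponents by at most one. -/
theorem QuotientSum.exists_hasDerivAt (hG : IsOpen G) (hc : IsNCircled G)
    (hα : HasMargin (logImage G) 1 fun j => (α j : ℝ)) (hδ : 0 < δ)
    (hαc : ∀ z ∈ G, δ ≤ ‖laurentMonomial α z - c‖) (hd : 0 < d) (hf : QuotientSum G α c d f)
    (j : Fin n) : ∃ h, QuotientSum G α c (d - 1) h ∧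
      ∀ z ∈ G, HasDerivAt (fun t : ℂ => f (z + t • Pi.single j 1)) (h z) 0 := by
  induction hf with
  | term b γ m hγ =>
    have hsingle : ∀ i, |((Pi.single j 1 : Fin n → ℤ) i : ℝ)| ≤ 1 := fun i => by
      rcases eq_or_ne i j with rfl | hi
      · simp
      · simp [hi]
    have hm1 : HasMargin (logImage G) (d - 1) fun i => ((γ - Pi.single j 1 : Fin n → ℤ) i : ℝ) :=
      hγ.perturb (c := 1) (fun i => by
        rw [Pi.sub_apply, Int.cast_sub, sub_sub_cancel_left, abs_neg]; exact hsingle i)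
        (by linarith)
    have hm2 : HasMargin (logImage G) d fun i => ((γ + (α - Pi.single j 1) : Fin n → ℤ) i : ℝ) :=
      (hγ.add hα).perturb (c := 1) (fun i => by
        simp only [Pi.add_apply, Pi.sub_apply, Int.cast_add, Int.cast_sub]
        rw [← add_sub_assoc, sub_sub_cancel_left, abs_neg]; exact hsingle i) (by linarith)
    have hm3 : HasMargin (logImage G) (d - 1) fun i => ((γ + (α - Pi.single j 1) : Fin n → ℤ) i : ℝ) :=
      hm2.perturb (c := 0) (fun i => by simp) (by linarith)
    refine ⟨_, (QuotientSum.term (b * γ j) _ m hm1).add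
      (QuotientSum.term (b * (-m * α j)) _ (m + 1) hm3), fun z hz => ?_⟩
    have hq : laurentMonomial α z - c ≠ 0 := norm_pos_iff.1 (hδ.trans_le (hαc z hz))
    have h1 := hasDerivAt_laurentMonomial_line (hγ.ne_zero_or_nonneg hG hc hd hz j)
    have h2 := hasDerivAt_laurentMonomial_line (hα.ne_zero_or_nonneg hG hc one_pos hz j)
    have hz0 : z + (0 : ℂ) • Pi.single j 1 = z := by rw [zero_smul, add_zero]
    have h3 : HasDerivAt (fun t : ℂ =>
        (laurentMonomial α (z + t • Pi.single j 1) - c) ^ (-(m : ℤ)))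
        (((-(m : ℤ) : ℤ) : ℂ) * (laurentMonomial α z - c) ^ (-(m : ℤ) - 1)
          * (α j * laurentMonomial (α - Pi.single j 1) z)) 0 := by
      have h4 := hasDerivAt_zpow (𝕜 := ℂ) (-(m : ℤ))
        (laurentMonomial α (z + (0 : ℂ) • Pi.single j 1) - c) (Or.inl (by rwa [hz0]))
      have := HasDerivAt.comp (0 : ℂ) h4 (h2.sub_const c)
      rwa [hz0] at this
    have h5 := (h1.mul h3).const_mul b
    rw [hz0] at h5
    refine h5.congr_deriv ?_
    rw [hγ.laurentMonomial_add hG hc hd hd hm2 hz]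
    have : -((m + 1 : ℕ) : ℤ) = -(m : ℤ) - 1 := by push_cast; ring
    rw [this]
    push_cast
    ring
  | add _ _ h1 h2 =>
    obtain ⟨f', hf', h1⟩ := h1
    obtain ⟨g', hg', h2⟩ := h2
    exact ⟨_, hf'.add hg', fun z hz => (h1 z hz).add (h2 z hz)⟩

theorem exists_quotientSum_complexPartial (hG : IsOpen G) (hc : IsNCircled G)
    (hα : HasMargin (logImage G) 1 fun j => (α j : ℝ)) (hδ : 0 < δ)
    (hαc : ∀ z ∈ G, δ ≤ ‖laurentMonomial α z - c‖) (hd : 0 < d)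
    (hf : ∃ h, QuotientSum G α c d h ∧ EqOn f h G) (j : Fin n) :
    ∃ h, QuotientSum G α c (d - 1) h ∧ EqOn (complexPartial j f) h G := by
  obtain ⟨h, hh, hfh⟩ := hf
  obtain ⟨h', hh', hder⟩ := hh.exists_hasDerivAt hG hc hα hδ hαc hd j
  refine ⟨h', hh', fun z hz => ?_⟩
  have hev : f =ᶠ[nhds z] h := Filter.eventually_of_mem (hG.mem_nhds hz) hfh
  rw [complexPartial, hev.lineDeriv_eq]
  exact (hder z hz).deriv

theorem exists_quotientSum_multiPartial (hG : IsOpen G) (hc : IsNCircled G)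
    (hα : HasMargin (logImage G) 1 fun j => (α j : ℝ)) (hδ : 0 < δ)
    (hαc : ∀ z ∈ G, δ ≤ ‖laurentMonomial α z - c‖) (hf : QuotientSum G α c d f)
    (ν : Fin n → ℕ) (hν : ((∑ j, ν j : ℕ) : ℝ) ≤ d) :
    ∃ h, QuotientSum G α c (d - (∑ j, ν j : ℕ)) h ∧ EqOn (multiPartial ν f) h G := by
  have hiter : ∀ (j : Fin n) (m : ℕ) (e : ℝ) (g : (Fin n → ℂ) → ℂ), (m : ℝ) ≤ e →
      (∃ h, QuotientSum G α c e h ∧ EqOn g h G) →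
      ∃ h, QuotientSum G α c (e - m) h ∧ EqOn ((complexPartial j)^[m] g) h G := by
    intro j m
    induction m with
    | zero => intro e g _ hg; simpa using hg
    | succ m ih =>
      intro e g hm hg
      push_cast at hm
      rw [Function.iterate_succ_apply']
      have := exists_quotientSum_complexPartial hG hc hα hδ hαc (by linarith)
        (ih e g (by linarith) hg) j
      rwa [sub_sub, ← Nat.cast_succ] at this
  rw [Fin.sum_univ_def] at hν ⊢
  unfold multiPartial
  generalize List.finRange n = l at hν ⊢
  induction l with
  | nil => exact ⟨f, by simpa using hf, fun _ _ => rfl⟩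
  | cons j l ih =>
    simp only [List.map_cons, List.sum_cons, Nat.cast_add] at hν ⊢
    have h0 : (0 : ℝ) ≤ ν j := Nat.cast_nonneg _
    have := hiter j (ν j) _ _ (by linarith) (ih (by linarith))
    rwa [sub_sub, add_comm (((List.map ν l).sum : ℕ) : ℝ)] at this

/-- Margin three is enough for integrability over `G` and for limits at the boundary; each of the
`k` derivatives uses up one more. -/
theorem QuotientSum.mem_lhDiamond_inter_akSpace (hG : IsOpen G) (hc : IsNCircled G)
    (hα : HasMargin (logImage G) 1 fun j => (α j : ℝ)) (hδ : 0 < δ)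
    (hαc : ∀ z ∈ G, δ ≤ ‖laurentMonomial α z - c‖) {k : ℕ} (hd : k + 3 ≤ d)
    (hf : QuotientSum G α c d f) : f ∈ LhDiamond k G ∩ AkSpace k G := by
  have hk : (0 : ℝ) ≤ k := Nat.cast_nonneg k
  have hhol : f ∈ holFunctions G := hf.differentiableOn hG hc hα hδ hαc (by linarith)
  have hpart : ∀ ν : Fin n → ℕ, ∑ j, ν j ≤ k →
      ∃ e, 3 ≤ e ∧ ∃ h, QuotientSum G α c e h ∧ EqOn (multiPartial ν f) h G := by
    intro ν hν
    have hν' : ((∑ j, ν j : ℕ) : ℝ) ≤ k := by exact_mod_cast hν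
    exact ⟨_, by linarith, exists_quotientSum_multiPartial hG hc hα hδ hαc hf ν (by linarith)⟩
  constructor
  · refine fun p hp => ⟨hhol, fun ν hν => ?_⟩
    obtain ⟨e, he, h, hh, heq⟩ := hpart ν hν
    obtain ⟨C, hC⟩ := hh.norm_le hG hc hδ hαc he
    have hcont := (hh.differentiableOn hG hc hα hδ hαc (by linarith)).continuousOn.congr heq
    exact memLp_of_norm_le_decayWeight hG hcont (fun z hz => by rw [heq hz]; exact hC z hz) hp
  · refine ⟨hhol, fun ν hν => ?_⟩
    obtain ⟨e, he, h, hh, heq⟩ := hpart ν hν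
    refine ⟨extendFrom G h, continuousOn_extendFrom subset_rfl fun z hz =>
      hh.exists_tendsto hG hc hδ hαc he hz, fun z hz => ?_⟩
    rw [heq hz]
    exact extendFrom_extends (hh.differentiableOn hG hc hα hδ hαc (by linarith)).continuousOn z hz

/-- Every Laurent monomial becomes a polynomial on multiplication by a polynomial monomial. -/
theorem laurentMonomial_mul_negPart (γ : Fin n → ℤ) {z : Fin n → ℂ} (hz : ∀ j, z j ≠ 0) :
    laurentMonomial γ z * laurentMonomial (fun j => max (-γ j) 0) z
      = laurentMonomial (fun j => max (γ j) 0) z := by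
  rw [← laurentMonomial_add γ _ hz]
  congr 1
  funext j
  simp only [Pi.add_apply]
  omega

/-- If `log |z₀|` lies outside the closure of `logImage G`, there is a monomial with
`|z ^ α| ≤ exp S < |z₀ ^ α|` on `G`; the function `z ^ β / (z ^ α - z₀ ^ α)`, with `β` of large margin,
does not extend holomorphically to `z₀`. -/
theorem isDomainOfHolomorphyFor_of_directionSpace_eq_bot (hG : IsDomainCn G) (hc : IsNCircled G)
    (hX : Convex ℝ (logImage G)) (hfat : IsFat G) (hdir : directionSpace (logImage G) = ⊥)
    (k : ℕ) : IsDomainOfHolomorphyFor (LhDiamond k G ∩ AkSpace k G) G := by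
  refine ⟨hG, ?_⟩
  rintro ⟨G₀, G', hG₀, hG', hsub, hnot, hext⟩
  have hXo := isOpen_logImage hG.1
  have hXn := nonempty_logImage hG hc
  obtain ⟨z₀, hz₀, h0, hlog⟩ :
      ∃ z ∈ G', (∀ j, z j ≠ 0) ∧ logAbs z ∉ closure (logImage G) := by
    by_contra hall
    push Not at hall
    refine hnot ?_
    rw [hfat]
    refine interior_maximal (fun z hz => ?_) hG'.1
    refine closure_minimal ?_ isClosed_closure
      ((dense_forall_ne_zero n).open_subset_closure_inter hG'.1 hz)
    rintro w ⟨hw, hw0⟩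
    obtain ⟨t, ht⟩ := exists_polarPoint_eq w hw0
    rw [← ht]
    exact polarPoint_mem_closure hc (hall w hw hw0) t
  obtain ⟨α, S, hα, hS, hlt⟩ := exists_int_separating hXo hX hXn hdir zero_le_one hlog
  obtain ⟨β, hβ⟩ := exists_int_hasMargin hXo hX hXn hdir (d := k + 3) (by positivity)
  set c := laurentMonomial α z₀ with hcdef
  have hδ : 0 < ‖c‖ - Real.exp S := by
    rw [hcdef, norm_laurentMonomial α h0, sub_pos]
    exact Real.exp_lt_exp.2 hlt
  have hαc : ∀ z ∈ G, ‖c‖ - Real.exp S ≤ ‖laurentMonomial α z - c‖ := by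
    intro z hz
    have h1 : ‖laurentMonomial α z‖ ≤ Real.exp S := by
      by_cases hz0 : ∀ j, z j ≠ 0
      · rw [norm_laurentMonomial α hz0]
        exact Real.exp_le_exp.2 (hS _ ((hc.logAbs_mem_iff hz0).2 hz))
      · push Not at hz0
        obtain ⟨j, hj⟩ := hz0
        rw [hα.laurentMonomial_eq_zero hG.1 hc one_pos hz hj, norm_zero]
        exact (Real.exp_pos S).le
    have h2 := norm_sub_norm_le c (laurentMonomial α z)
    rw [norm_sub_rev] at h2
    linarith
  obtain ⟨g, hg, hgf⟩ := hext _ ((QuotientSum.term 1 β 1 hβ).mem_lhDiamond_inter_akSpace hG.1 hc hα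
    hδ hαc le_rfl)
  -- clearing denominators gives an identity between functions holomorphic on `G'`
  have hpoly : ∀ η : Fin n → ℤ, (∀ j, 0 ≤ η j) → Differentiable ℂ (laurentMonomial η) :=
    fun η hη z => differentiableAt_laurentMonomial fun j => Or.inr (hη j)
  have hpos : ∀ η : Fin n → ℤ, Differentiable ℂ (laurentMonomial fun j => max (η j) 0) :=
    fun η => hpoly _ fun j => le_max_right _ _
  have hneg : ∀ η : Fin n → ℤ, Differentiable ℂ (laurentMonomial fun j => max (-η j) 0) :=
    fun η => hpoly _ fun j => le_max_right _ _
  let E : (Fin n → ℂ) → ℂ := fun z =>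
    g z * laurentMonomial (fun j => max (-β j) 0) z * (laurentMonomial (fun j => max (α j) 0) z
      - c * laurentMonomial (fun j => max (-α j) 0) z)
    - laurentMonomial (fun j => max (β j) 0) z * laurentMonomial (fun j => max (-α j) 0) z
  have hE : DifferentiableOn ℂ E G' :=
    ((hg.mul (hneg β).differentiableOn).mul ((hpos α).differentiableOn.sub
      ((hneg α).differentiableOn.const_mul c))).sub
      ((hpos β).differentiableOn.mul (hneg α).differentiableOn)
  obtain ⟨w, r, hr, hball, hball0⟩ := hG₀.exists_ball_subset
  have hE0 : E =ᶠ[nhds w] 0 := by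
    refine Filter.eventually_of_mem (Metric.ball_mem_nhds w hr) fun z hz => ?_
    have hz0 := hball0 z hz
    have hzG := (hsub (hball hz)).1
    have hq : laurentMonomial α z - c ≠ 0 := norm_pos_iff.1 (hδ.trans_le (hαc z hzG))
    simp only [E, hgf (hball hz), ← laurentMonomial_mul_negPart α hz0,
      ← laurentMonomial_mul_negPart β hz0, one_mul, Nat.cast_one, zpow_neg, zpow_one,
      Pi.zero_apply]
    field_simp
    ring
  have hEz := hE.eqOn_zero_of_eventuallyEq hG'.1 hG'.2.isPreconnected
    (hsub (hball (Metric.mem_ball_self hr))).2 hE0 hz₀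
  simp only [E, ← laurentMonomial_mul_negPart α h0, ← hcdef, sub_self, mul_zero, zero_sub,
    Pi.zero_apply, neg_eq_zero, mul_eq_zero] at hEz
  rcases hEz with h | h <;> exact laurentMonomial_ne_zero _ h0 h

end Quotients

/-! ### The equivalence -/

theorem isFat_and_exists_mem_lhSpace {n : ℕ} {G : Set (Fin n → ℂ)} (hG : IsDomainOfHolomorphy G)
    (hc : IsNCircled G) (hne : G ≠ univ)
    (h : IsDomainOfHolomorphyFor (LhDiamond 0 G ∩ AkSpace 0 G) G) :
    IsFat G ∧ ∃ p : ℝ≥0∞, 1 ≤ p ∧ p ≠ ∞ ∧ ∃ f ∈ LhSpace p 0 G, ∃ z ∈ G, f z ≠ 0 := by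
  refine ⟨isFat_of_isDomainOfHolomorphyFor hc (hG.convex_logImage hc) h fun f hf => ?_,
    1, le_rfl, ENNReal.one_ne_top, ?_⟩
  · obtain ⟨hhol, hp⟩ := hf.1 ∞ le_top
    have := hp 0 (by simp)
    rw [multiPartial_zero] at this
    exact ⟨hhol, norm_le_of_memLp_top hG.1.1 hhol.continuousOn this⟩
  · by_contra hall
    push Not at hall
    refine h.2 ⟨G, univ, hG.1, ⟨isOpen_univ, ?_⟩, fun z hz => ⟨hz, mem_univ z⟩, ?_, ?_⟩
    · exact isConnected_univ
    · exact fun hsub => hne (univ_subset_iff.1 hsub)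
    · exact fun f hf => ⟨0, differentiableOn_const 0, fun z hz => (hall f (hf.1 1 le_rfl) z hz).symm⟩

theorem ne_univ_of_directionSpace_eq_bot {n : ℕ} (hn : 1 ≤ n) {G : Set (Fin n → ℂ)}
    (hdir : directionSpace (logImage G) = ⊥) : G ≠ univ := by
  rintro rfl
  have hle : (⊤ : Submodule ℝ (Fin n → ℝ)) ≤ directionSpace (logImage univ) := by
    refine (directionSpace_isGreatest _).2 ?_
    have : logImage (univ : Set (Fin n → ℂ)) = univ := rfl
    rw [this]
    exact Subset.antisymm (subset_univ _) fun x _ => ⟨x, mem_univ _, 0, by simp, by simp⟩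
  rw [hdir, top_le_iff] at hle
  have := Fin.pos_iff_nonempty.1 hn
  exact bot_ne_top hle

theorem proposition3 (n : ℕ) (hn : 1 ≤ n) (G : Set (Fin n → ℂ))
    (hcirc : IsNCircled G) (hG : IsDomainOfHolomorphy G) :
    List.TFAE [
      IsFat G ∧ directionSpace (logImage G) = ⊥,
      IsFat G ∧ ∃ p : ℝ≥0∞, 1 ≤ p ∧ p ≠ ∞ ∧ ∃ f ∈ LhSpace p 0 G, ∃ z ∈ G, f z ≠ 0,
      G ≠ univ ∧ ∀ k : ℕ, IsDomainOfHolomorphyFor (LhDiamond k G ∩ AkSpace k G) G] := by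
  tfae_have 1 → 3 := fun ⟨hfat, hdir⟩ => ⟨ne_univ_of_directionSpace_eq_bot hn hdir, fun k =>
    isDomainOfHolomorphyFor_of_directionSpace_eq_bot hG.1 hcirc (hG.convex_logImage hcirc) hfat
      hdir k⟩
  tfae_have 3 → 2 := fun ⟨hne, h⟩ => isFat_and_exists_mem_lhSpace hG hcirc hne (h 0)
  tfae_have 2 → 1 := by
    rintro ⟨hfat, p, hp, hp', f, ⟨hhol, hf⟩, hz⟩
    have := hf 0 (by simp)
    rw [multiPartial_zero] at this
    exact ⟨hfat, directionSpace_eq_bot_of_memLp hG.1 hcirc hhol hp hp' this hz⟩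
  tfae_finish
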